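/- Let $F\subset\mathbb{R}^2_{\ge}$ be a compact convex polygon (with non-empty interior), and let $\mathcal P=\bigcup_{i=0}^{\infty} iF\cap\mathbb{N}^2$, where $iF=\{iX\mid X\in F\}$, be its semigroup; it is a submonoid of $\mathbb N^2$. Let $L_{\mathbb Q_\ge}(F)=\{\sum_{j=1}^p q_ja_j\mid p\in\mathbb N,\ q_j\in\mathbb{Q}_{\ge},\ a_j\in F\}$ be the cone generated by $F$. A ray is a line through the origin $O$; it is extremal for the cone if it contains a point of the cone other than $O$ and a sum of two elements of the cone lies on it only if both summands do. (a) The cone $L_{\mathbb Q_\ge}(F)$ has exactly two extremal rays $\tau_1\ne\tau_2$, and $\mathcal P$ is finitely generated (that is, $\mathcal P=\{\sum_j\lambda_ja_j\mid\lambda_j\in\mathbb N\}$ for some finite set $\{a_1,\dots,a_r\}\subset\mathbb{N}^2$) if and only if each of $F\cap\tau_1$ and $F\cap\tau_2$ contains a point of $\mathbb{Q}^2$ different from $O$. (b) There is one algorithm that, for every such polygon $F$ whose semigroup $\mathcal P$ is finitely generated, given the coordinates of any finite list of points with convex hull $F$ (for instance the vertices of $F$), halts and outputs a list without repetitions of the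 elements of the minimal system of generators of $\mathcal P$, that is, of a generating set no proper subset of which generates $\mathcal P$. Here an algorithm computes exactly with its real input, as a Blum--Shub--Smale machine without real constants does: on input $x\in\mathbb R^m$, a fixed Turing-computable function of $m$ and of the answers received so far determines either the next question, of the form "is $q(x)>0$?" with $q$ a polynomial in $m$ variables with integer coefficients, which is answered correctly, or the output, at which the algorithm halts. -/

import Mathlib

open scoped Pointwise

/-! ### Convex polygons in the first quadrant and their semigroups -/

/-- A compact convex polygon in `ℝ²_≥`, presented by a finite list of points of which it is the
convex hull (for instance its vertices in clockwise order). A polygon is two-dimensional, so its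
interior is not empty. -/
structure ConvexPolygon where
  points : List (ℝ × ℝ)
  nonneg : ∀ p ∈ points, 0 ≤ p.1 ∧ 0 ≤ p.2
  interior_nonempty : (interior (convexHull ℝ {p | p ∈ points})).Nonempty

/-- The point set `F ⊆ ℝ²` of a polygon. -/
def ConvexPolygon.body (F : ConvexPolygon) : Set (ℝ × ℝ) :=
  convexHull ℝ {p | p ∈ F.points}

theorem ConvexPolygon.convex_body (F : ConvexPolygon) : Convex ℝ F.body :=
  convex_convexHull ℝ _

theorem ConvexPolygon.nonempty_body (F : ConvexPolygon) : F.body.Nonempty :=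
  F.interior_nonempty.mono interior_subset

/-- For a nonempty convex `F ⊆ ℝ²`, the semigroup `⋃_{i ≥ 0} iF ∩ ℕ²`, where
`iF = {iX | X ∈ F}`. -/
def convexSemigroup (F : Set (ℝ × ℝ)) (hF : Convex ℝ F) (hne : F.Nonempty) :
    AddSubmonoid (ℕ × ℕ) where
  carrier := {n | ∃ i : ℕ, ((n.1 : ℝ), (n.2 : ℝ)) ∈ (i : ℝ) • F}
  zero_mem' := ⟨0, by simp [Set.zero_smul_set hne]⟩
  add_mem' := by
    rintro a b ⟨i, hi⟩ ⟨j, hj⟩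
    refine ⟨i + j, ?_⟩
    have h := Set.add_mem_add hi hj
    rw [← hF.add_smul (Nat.cast_nonneg i) (Nat.cast_nonneg j)] at h
    simpa using h

/-- The polygonal semigroup `𝒫` of `F`. -/
def ConvexPolygon.semigroup (F : ConvexPolygon) : AddSubmonoid (ℕ × ℕ) :=
  convexSemigroup F.body F.convex_body F.nonempty_body

/-- `B` is a minimal system of generators of `S`: it generates `S`, and no proper subset does. -/
def IsMinimalGeneratingSystem (S : AddSubmonoid (ℕ × ℕ)) (B : Set (ℕ × ℕ)) : Prop :=
  AddSubmonoid.closure B = S ∧ ∀ B' : Set (ℕ × ℕ), B' ⊂ B → AddSubmonoid.closure B' ≠ S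

/-! ### Cones and extremal rays -/

/-- The cone `{∑ qᵢ aᵢ | qᵢ ∈ ℚ_≥, aᵢ ∈ A}`. -/
def rationalCone (A : Set (ℝ × ℝ)) : Set (ℝ × ℝ) :=
  (Submodule.span ℚ≥0 A : Set (ℝ × ℝ))

/-- A ray (a line `τ` through the origin) is extremal for the cone `C` if it meets `C` outside the
origin and a sum of two elements of `C` lies on `τ` only if both summands do. -/
def IsExtremalRay (C : Set (ℝ × ℝ)) (τ : Submodule ℝ (ℝ × ℝ)) : Prop :=
  Module.finrank ℝ τ = 1 ∧ (∃ x ∈ C, x ∈ τ ∧ x ≠ 0) ∧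
    ∀ x ∈ C, ∀ y ∈ C, x + y ∈ τ → x ∈ τ ∧ y ∈ τ

/-- `A` contains a rational point other than the origin. -/
def HasNonzeroRationalPoint (A : Set (ℝ × ℝ)) : Prop :=
  ∃ a b : ℚ, (a, b) ≠ (0, 0) ∧ ((a : ℝ), (b : ℝ)) ∈ A

/-! ### Algorithms with real input

The input is a finite list of real numbers, on which the algorithm can do exact arithmetic and
exact comparisons, as on a Blum–Shub–Smale machine (real RAM) without real constants; the output
is discrete. All branchings of such a machine are on signs of polynomials with integer coefficients
in the input, so a computation is a dialogue in which the control, a Turing-computable function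
of the number of inputs and of the answers received so far, either asks for such a sign or
stops with an output. -/

/-- A polynomial with integer coefficients, as the list of its monomials: `(c, [e₀, e₁, …])`
stands for `c x₀ ^ e₀ x₁ ^ e₁ ⋯`. -/
abbrev IntPoly := List (ℤ × List ℕ)

/-- The value of a polynomial at `x = [x₀, x₁, …]`. -/
noncomputable def IntPoly.value (q : IntPoly) (x : List ℝ) : ℝ :=
  (q.map fun m => (m.1 : ℝ) * (List.zipWith (fun t e => t ^ e) x m.2).prod).sum

/-- An algorithm on finite lists of reals with outputs in `α`. From the length of the input and the
list of answers so far (the latest one first), `next` computes either the next question,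
a polynomial `q` that stands for the question whether `0 < q(x)`, or the output. -/
structure RealAlgorithm (α : Type) [Primcodable α] where
  next : ℕ × List Bool → IntPoly ⊕ α
  computable_next : Computable next

open Classical in
/-- `A.OutputsFrom x h a`: on input `x`, after the answers `h`, the algorithm stops after finitely
many further questions, and its output is `a`. -/
inductive RealAlgorithm.OutputsFrom {α : Type} [Primcodable α] (A : RealAlgorithm α)
    (x : List ℝ) : List Bool → α → Prop
  | halt (h : List Bool) (a : α) (stop_eq : A.next (x.length, h) = Sum.inr a) :
      RealAlgorithm.OutputsFrom A x h a
  | ask (h : List Bool) (a : α) (q : IntPoly) (ask_eq : A.next (x.length, h) = Sum.inl q)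
      (rest : RealAlgorithm.OutputsFrom A x (decide (0 < IntPoly.value q x) :: h) a) :
      RealAlgorithm.OutputsFrom A x h a

/-- On input `x` the algorithm halts with output `a`. -/
def RealAlgorithm.Outputs {α : Type} [Primcodable α] (A : RealAlgorithm α)
    (x : List ℝ) (a : α) : Prop :=
  A.OutputsFrom x [] a

/-- The coordinates `x₁, y₁, x₂, y₂, …` of the points that present a polygon. -/
def ConvexPolygon.coordinates (F : ConvexPolygon) : List ℝ :=
  F.points.flatMap fun p => [p.1, p.2]

/-! Two of the given points, of least and greatest slope, span the extremal rays. Let a linear form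
`f` be nonnegative on `F` and vanish on one of them. If finitely many generators are given and none
but `0` lies on that ray, then `f x ≥ c (x.1 + x.2)` on them for some `c > 0`, hence on all of `𝒫`.
But `F` has interior points near the ray, so it has rational points that violate this inequality,
and so do their integral multiples in `𝒫`. So some nonzero generator is on the ray, and dividing it
by its index gives a rational point of `F` (`exists_rational_of_fg`).

Conversely, let `P`, `Q` be rational points of `F` on the two rays, `u = d P` and `v = d Q` lattice
points, `α`, `β` the coordinates with respect to `P`, `Q`, and `σ = α + β`. Every `x` of the cone
lies in `σ(x) F`, so an element of `𝒫` has an index within `1` of `σ(x)`. The given points are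
finitely many, so those off the line `PQ` satisfy `|1 - σ| ≥ 1 / K` for some `K`. Hence the part of
`x` responsible for the difference between index and `σ(x)` can be chosen bounded, and the rest is a
combination of `P` and `Q`: if `α x ≥ d + K + 1`, then `x - u` is again in `𝒫`
(`IsFrame.sub_mem_smul`), and likewise for `β` and `v`. Descent shows that `𝒫` is generated by its
elements in an explicit box (`IsLatticeFrame.mem_closure`).

Rationality of a point cannot be read off from finitely many signs, but it can be searched for: `d,
K, u, v` are natural numbers, and the conditions on them are signs of integer polynomials in the
input, membership in `jF` being tested on triangles of given points (`mem_smul_body_iff`). The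
algorithm asks all questions of a fixed family in turn and stops when the answers verify a
candidate. The frame then bounds both the box and the indices, so the answers determine `𝒫` in the
box, and its elements there that are not sums of two nonzero ones form the minimal system. -/

/-! ### Dialogues that follow a fixed sequence of questions -/

open Classical in
/-- The answers to the first `n` questions `Q (x.length, 0), Q (x.length, 1), …` on input `x`,
the latest one first. -/
noncomputable def signAnswers (Q : ℕ × ℕ → IntPoly) (x : List ℝ) : ℕ → List Bool
  | 0 => []
  | n + 1 => decide (0 < (Q (x.length, n)).value x) :: signAnswers Q x n

@[simp] theorem length_signAnswers (Q : ℕ × ℕ → IntPoly) (x : List ℝ) (n : ℕ) :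
    (signAnswers Q x n).length = n := by
  induction n with
  | zero => rfl
  | succ n ih => simp [signAnswers, ih]

open Classical in
theorem signAnswers_reverse_getElem? (Q : ℕ × ℕ → IntPoly) (x : List ℝ) (n z : ℕ) :
    (signAnswers Q x n).reverse[z]? =
      if z < n then some (decide (0 < (Q (x.length, z)).value x)) else none := by
  induction n with
  | zero => simp [signAnswers]
  | succ n ih =>
    rw [signAnswers, List.reverse_cons]
    rcases lt_trichotomy z n with h | h | h
    · rw [List.getElem?_append_left (by simpa using h), ih, if_pos h, if_pos (by omega)]
    · subst h
      rw [List.getElem?_append_right (by simp)]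
      simp
    · rw [List.getElem?_eq_none (by simp; omega), if_neg (by omega)]

/-- Asking a primitive recursive sequence of questions until a primitive recursive test succeeds
is a real algorithm. -/
theorem exists_realAlgorithm_of_primrec {α : Type} [Primcodable α]
    {Q : ℕ × ℕ → IntPoly} (hQ : Primrec Q)
    {test : ℕ × List Bool → Prop} (htest : PrimrecPred test)
    {out : ℕ × List Bool → α} (hout : Primrec out) :
    ∃ A : RealAlgorithm α, ∀ x : List ℝ, (∃ n, test (x.length, signAnswers Q x n)) →
      ∃ n, test (x.length, signAnswers Q x n) ∧
        A.Outputs x (out (x.length, signAnswers Q x n)) := by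
  classical
  have hnext : Primrec fun s : ℕ × List Bool =>
      if test s then (Sum.inr (out s) : IntPoly ⊕ α) else Sum.inl (Q (s.1, s.2.length)) :=
    Primrec.ite htest (Primrec.sumInr.comp hout)
      (Primrec.sumInl.comp (hQ.comp (Primrec.fst.pair (Primrec.list_length.comp Primrec.snd))))
  refine ⟨⟨_, hnext.to_comp⟩, fun x hx => ⟨Nat.find hx, Nat.find_spec hx, ?_⟩⟩
  -- Backward induction: `k` is the number of questions still to be asked before the first success
  -- of the test.
  have key : ∀ k ≤ Nat.find hx, RealAlgorithm.OutputsFrom ⟨_, hnext.to_comp⟩ x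
      (signAnswers Q x (Nat.find hx - k)) (out (x.length, signAnswers Q x (Nat.find hx))) := by
    intro k
    induction k with
    | zero =>
      intro _
      exact .halt _ _ (if_pos (Nat.find_spec hx))
    | succ k ih =>
      intro hk
      have hlt : Nat.find hx - (k + 1) < Nat.find hx := by omega
      refine .ask _ _ (Q (x.length, Nat.find hx - (k + 1))) ?_ ?_
      · simp [Nat.find_min hx hlt]
      · have h := ih (by omega)
        rw [show Nat.find hx - k = Nat.find hx - (k + 1) + 1 by omega, signAnswers] at h
        convert h
  simpa [signAnswers, RealAlgorithm.Outputs] using key _ le_rfl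

/-! ### A family of questions about pairs of points -/

/-- The encoding of `ℤ` sends `n` to `2 n` and `-(n + 1)` to `2 n + 1`, so the map is doubling on
codes. -/
theorem primrec_intCast : Primrec (fun n : ℕ => (n : ℤ)) := by
  refine Primrec.encode_iff.1 ((Primrec.nat_mul.comp (Primrec.const 2) Primrec.id).of_eq ?_)
  intro n
  rfl

theorem primrec_neg_intCast : Primrec (fun n : ℕ => -(n : ℤ)) := by
  -- On codes the map is `2 n - 1`; truncated subtraction gives the right value also at `n = 0`.
  refine Primrec.encode_iff.1
    (Primrec.nat_sub.comp (Primrec.nat_mul.comp (Primrec.const 2) Primrec.id)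
      (Primrec.const 1) |>.of_eq ?_)
  rintro (_ | n)
  · rfl
  · change 2 * (n + 1) - 1 = 2 * n + 1
    omega

/-- The exponents of the monomial `xᵢ xⱼ` in `m` variables, where `xᵢ` is read as `1` for
`m ≤ i`. -/
def pairExponents (m i j : ℕ) : List ℕ :=
  (List.range m).map fun t => (if t = i then 1 else 0) + (if t = j then 1 else 0)

theorem prod_zipWith_pow_add (x : List ℝ) (l : List ℕ) (f g : ℕ → ℕ) :
    (List.zipWith (fun t e => t ^ e) x (l.map fun t => f t + g t)).prod =
      (List.zipWith (fun t e => t ^ e) x (l.map f)).prod *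
        (List.zipWith (fun t e => t ^ e) x (l.map g)).prod := by
  induction x generalizing l with
  | nil => simp
  | cons a x ih =>
    cases l with
    | nil => simp
    | cons b l =>
      simp only [List.map_cons, List.zipWith_cons_cons, List.prod_cons, ih, pow_add]
      ring

/-- The default value `1` lets an index out of range stand for the constant factor, so that
`pairExponents` also yields linear and constant monomials. -/
theorem prod_zipWith_pow_single (x : List ℝ) (i : ℕ) :
    (List.zipWith (fun t e => t ^ e) x
      ((List.range x.length).map fun t => if t = i then 1 else 0)).prod = x.getD i 1 := by
  induction x generalizing i with
  | nil => simp
  | cons a x ih =>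
    rw [List.length_cons, List.range_succ_eq_map, List.map_cons, List.map_map,
      List.zipWith_cons_cons, List.prod_cons]
    cases i with
    | zero =>
      -- The remaining exponents all vanish; this is the induction hypothesis for an index just out
      -- of range.
      have h := ih x.length
      rw [List.getD_eq_default _ _ le_rfl] at h
      have h2 : (List.range x.length).map ((fun t => if t = 0 then 1 else 0) ∘ Nat.succ) =
          (List.range x.length).map fun t => if t = x.length then 1 else 0 := by
        refine List.map_congr_left fun t ht => ?_
        have := List.mem_range.1 ht
        simp [this.ne]
      rw [h2, h]
      simp
    | succ i =>
      have h2 : ((fun t => if t = i + 1 then 1 else 0) ∘ Nat.succ) =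
          fun t => if t = i then 1 else 0 := by
        funext t
        simp
      rw [h2, ih]
      simp

theorem prod_pairExponents (x : List ℝ) (i j : ℕ) :
    (List.zipWith (fun t e => t ^ e) x (pairExponents x.length i j)).prod =
      x.getD i 1 * x.getD j 1 := by
  rw [pairExponents, prod_zipWith_pow_add, prod_zipWith_pow_single, prod_zipWith_pow_single]

theorem primrec_pairExponents {α : Type*} [Primcodable α] {m i j : α → ℕ} (hm : Primrec m)
    (hi : Primrec i) (hj : Primrec j) : Primrec fun a => pairExponents (m a) (i a) (j a) := by
  have hind : ∀ {i : α → ℕ}, Primrec i → Primrec₂ fun (a : α) (t : ℕ) =>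
      if t = i a then 1 else 0 := fun hi =>
    Primrec.ite (Primrec.eq.comp Primrec.snd (hi.comp Primrec.fst)) (Primrec.const 1)
      (Primrec.const 0)
  exact Primrec.list_map (Primrec.list_range.comp hm) (Primrec.nat_add.comp₂ (hind hi) (hind hj))

/-- The code `((a, b, c), (a', b', c'), j, k, l)` of the polynomial
`j (xₖ yₗ - yₖ xₗ) + a xₗ + b yₖ + c - a' xₖ - b' yₗ - c'`. -/
abbrev SignQuery := (ℕ × ℕ × ℕ) × (ℕ × ℕ × ℕ) × ℕ × ℕ × ℕ

/-- The polynomial with the given code, in `m` variables `x₀, y₀, x₁, y₁, …`. -/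
def SignQuery.poly (m : ℕ) (q : SignQuery) : IntPoly :=
  [((q.2.2.1 : ℤ), pairExponents m (2 * q.2.2.2.1) (2 * q.2.2.2.2 + 1)),
    (-(q.2.2.1 : ℤ), pairExponents m (2 * q.2.2.2.1 + 1) (2 * q.2.2.2.2)),
    ((q.1.1 : ℤ), pairExponents m (2 * q.2.2.2.2) m),
    ((q.1.2.1 : ℤ), pairExponents m (2 * q.2.2.2.1 + 1) m),
    ((q.1.2.2 : ℤ), pairExponents m m m),
    (-(q.2.1.1 : ℤ), pairExponents m (2 * q.2.2.2.1) m),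
    (-(q.2.1.2.1 : ℤ), pairExponents m (2 * q.2.2.2.2 + 1) m),
    (-(q.2.1.2.2 : ℤ), pairExponents m m m)]

theorem SignQuery.value_poly (x : List ℝ) (a b c a' b' c' j k l : ℕ) :
    (SignQuery.poly x.length ((a, b, c), (a', b', c'), j, k, l)).value x =
      j * (x.getD (2 * k) 1 * x.getD (2 * l + 1) 1 - x.getD (2 * k + 1) 1 * x.getD (2 * l) 1) +
        a * x.getD (2 * l) 1 + b * x.getD (2 * k + 1) 1 + c -
        a' * x.getD (2 * k) 1 - b' * x.getD (2 * l + 1) 1 - c' := by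
  have h : x.getD x.length 1 = 1 := List.getD_eq_default _ _ le_rfl
  simp only [IntPoly.value, SignQuery.poly, List.map_cons, List.map_nil, List.sum_cons,
    List.sum_nil, prod_pairExponents, h]
  push_cast
  ring

theorem SignQuery.primrec_poly : Primrec₂ SignQuery.poly := by
  have hj : Primrec fun s : ℕ × SignQuery => s.2.2.2.1 :=
    .comp .fst (.comp .snd (.comp .snd .snd))
  have hk : Primrec fun s : ℕ × SignQuery => 2 * s.2.2.2.2.1 :=
    Primrec.nat_mul.comp (.const 2) (.comp .fst (.comp .snd (.comp .snd (.comp .snd .snd))))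
  have hl : Primrec fun s : ℕ × SignQuery => 2 * s.2.2.2.2.2 :=
    Primrec.nat_mul.comp (.const 2) (.comp .snd (.comp .snd (.comp .snd (.comp .snd .snd))))
  have hk' := Primrec.succ.comp hk
  have hl' := Primrec.succ.comp hl
  have hm : Primrec fun s : ℕ × SignQuery => s.1 := .fst
  have ha : Primrec fun s : ℕ × SignQuery => s.2.1.1 := .comp .fst (.comp .fst .snd)
  have hb : Primrec fun s : ℕ × SignQuery => s.2.1.2.1 :=
    .comp .fst (.comp .snd (.comp .fst .snd))
  have hc : Primrec fun s : ℕ × SignQuery => s.2.1.2.2 :=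
    .comp .snd (.comp .snd (.comp .fst .snd))
  have ha' : Primrec fun s : ℕ × SignQuery => s.2.2.1.1 :=
    .comp .fst (.comp .fst (.comp .snd .snd))
  have hb' : Primrec fun s : ℕ × SignQuery => s.2.2.1.2.1 :=
    .comp .fst (.comp .snd (.comp .fst (.comp .snd .snd)))
  have hc' : Primrec fun s : ℕ × SignQuery => s.2.2.1.2.2 :=
    .comp .snd (.comp .snd (.comp .fst (.comp .snd .snd)))
  have cons : ∀ {f : ℕ × SignQuery → ℤ} {i j : ℕ × SignQuery → ℕ} {t : ℕ × SignQuery → IntPoly},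
      Primrec f → Primrec i → Primrec j → Primrec t →
      Primrec fun s => ((f s, pairExponents s.1 (i s) (j s)) :: t s : IntPoly) :=
    fun hf hi hj ht => Primrec.list_cons.comp (hf.pair (primrec_pairExponents hm hi hj)) ht
  exact cons (primrec_intCast.comp hj) hk hl' <| cons (primrec_neg_intCast.comp hj) hk' hl <|
    cons (primrec_intCast.comp ha) hl hm <| cons (primrec_intCast.comp hb) hk' hm <|
    cons (primrec_intCast.comp hc) hm hm <| cons (primrec_neg_intCast.comp ha') hk hm <|
    cons (primrec_neg_intCast.comp hb') hl' hm <| cons (primrec_neg_intCast.comp hc') hm hm <|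
    Primrec.const []

/-! ### Geometry of polygons -/

/-- The linear form `p ↦ det (e, p)`. -/
noncomputable def crossForm (e : ℝ × ℝ) : ℝ × ℝ →ₗ[ℝ] ℝ :=
  e.1 • LinearMap.snd ℝ ℝ ℝ - e.2 • LinearMap.fst ℝ ℝ ℝ

@[simp] theorem crossForm_apply (e p : ℝ × ℝ) : crossForm e p = e.1 * p.2 - e.2 * p.1 := rfl

/-- The inclusion of `ℕ²` into `ℝ²`. -/
noncomputable def natPoint : ℕ × ℕ →+ ℝ × ℝ :=
  (Nat.castAddMonoidHom ℝ).prodMap (Nat.castAddMonoidHom ℝ)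

@[simp] theorem natPoint_apply (x : ℕ × ℕ) : natPoint x = ((x.1 : ℝ), (x.2 : ℝ)) := rfl

namespace ConvexPolygon

variable (F : ConvexPolygon)

theorem mem_semigroup {x : ℕ × ℕ} :
    x ∈ F.semigroup ↔ ∃ i : ℕ, natPoint x ∈ (i : ℝ) • F.body := Iff.rfl

theorem mem_body_of_mem_points {p : ℝ × ℝ} (hp : p ∈ F.points) : p ∈ F.body :=
  subset_convexHull ℝ _ hp

variable {F}

theorem body_subset {C : Set (ℝ × ℝ)} (hC : Convex ℝ C) (h : ∀ p ∈ F.points, p ∈ C) :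
    F.body ⊆ C :=
  convexHull_min h hC

theorem form_nonneg {f : ℝ × ℝ →ₗ[ℝ] ℝ} (h : ∀ p ∈ F.points, 0 ≤ f p) {z : ℝ × ℝ}
    (hz : z ∈ F.body) : 0 ≤ f z :=
  body_subset (convex_halfSpace_ge f.isLinear 0) h hz

theorem fst_nonneg {z : ℝ × ℝ} (hz : z ∈ F.body) : 0 ≤ z.1 :=
  form_nonneg (f := LinearMap.fst ℝ ℝ ℝ) (fun p hp => (F.nonneg p hp).1) hz

theorem snd_nonneg {z : ℝ × ℝ} (hz : z ∈ F.body) : 0 ≤ z.2 :=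
  form_nonneg (f := LinearMap.snd ℝ ℝ ℝ) (fun p hp => (F.nonneg p hp).2) hz

/-- The points of a polygon do not lie on a line. -/
theorem exists_form_ne (F : ConvexPolygon) {f : ℝ × ℝ →ₗ[ℝ] ℝ} (hf : f ≠ 0) (c : ℝ) :
    ∃ p ∈ F.points, f p ≠ c := by
  by_contra! h
  obtain ⟨z, hz⟩ := F.interior_nonempty
  obtain ⟨w, hw⟩ : ∃ w, f w ≠ 0 := by
    by_contra! h0
    exact hf (LinearMap.ext h0)
  have hsub : F.body ⊆ {x | f x = c} := body_subset (convex_hyperplane f.isLinear c) h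
  have hcont : Filter.Tendsto (fun t : ℝ => z + t • w) (nhds 0) (nhds z) := by
    have : Continuous fun t : ℝ => z + t • w := by fun_prop
    simpa using this.tendsto 0
  have hev := hcont.eventually (isOpen_interior.mem_nhds hz)
  obtain ⟨t, ht, ht0⟩ := ((hev.filter_mono nhdsWithin_le_nhds).and
    (self_mem_nhdsWithin : {0}ᶜ ∈ nhdsWithin (0 : ℝ) {0}ᶜ)).exists
  have h1 : f (z + t • w) = c := hsub (interior_subset ht)
  have h2 : f z = c := hsub (interior_subset hz)
  rw [map_add, map_smul, h2, smul_eq_mul] at h1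
  exact mul_ne_zero ht0 hw (by linarith)

theorem crossForm_ne_zero {e : ℝ × ℝ} (he : e ≠ 0) : crossForm e ≠ 0 := by
  intro h
  have h1 := LinearMap.congr_fun h (1, 0)
  have h2 := LinearMap.congr_fun h (0, 1)
  simp at h1 h2
  exact he (Prod.ext h2 h1)

theorem add_pos_of_ne_zero {p : ℝ × ℝ} (h1 : 0 ≤ p.1) (h2 : 0 ≤ p.2) (hp : p ≠ 0) :
    0 < p.1 + p.2 := by
  rcases h1.eq_or_lt with h | h
  · rcases h2.eq_or_lt with h' | h'
    · exact absurd (Prod.ext h.symm h'.symm) hp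
    · linarith
  · linarith

/-- Among the points of a polygon there are two that span the extremal rays of its cone. -/
theorem exists_extremal (F : ConvexPolygon) : ∃ e₁ ∈ F.points, ∃ e₂ ∈ F.points,
    (∀ p ∈ F.points, 0 ≤ crossForm e₁ p) ∧ (∀ p ∈ F.points, crossForm e₂ p ≤ 0) ∧
      0 < crossForm e₁ e₂ := by
  classical
  set T := F.points.toFinset.filter (· ≠ 0) with hT
  have hmem : ∀ p, p ∈ T ↔ p ∈ F.points ∧ p ≠ 0 := by simp [hT]
  have hpos : ∀ p ∈ T, 0 < p.1 + p.2 := fun p hp =>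
    add_pos_of_ne_zero (F.nonneg p ((hmem p).1 hp).1).1 (F.nonneg p ((hmem p).1 hp).1).2
      ((hmem p).1 hp).2
  have hne : T.Nonempty := by
    obtain ⟨p, hp, hp0⟩ := F.exists_form_ne (f := LinearMap.fst ℝ ℝ ℝ)
      (fun h => by simpa using LinearMap.congr_fun h (1, 0)) 0
    exact ⟨p, (hmem p).2 ⟨hp, fun h => hp0 (by simp [h])⟩⟩
  -- In the quadrant the quotient `p.2 / (p.1 + p.2)` increases with the angle and, unlike the usual
  -- slope, is finite on the vertical axis.
  have hslope : ∀ e ∈ T, ∀ p ∈ T, e.2 / (e.1 + e.2) ≤ p.2 / (p.1 + p.2) →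
      0 ≤ crossForm e p := by
    intro e he p hp h
    rw [div_le_div_iff₀ (hpos e he) (hpos p hp)] at h
    rw [crossForm_apply]
    linarith
  obtain ⟨e₁, h₁, hmin⟩ := T.exists_min_image (fun p => p.2 / (p.1 + p.2)) hne
  obtain ⟨e₂, h₂, hmax⟩ := T.exists_max_image (fun p => p.2 / (p.1 + p.2)) hne
  have H₁ : ∀ p ∈ F.points, 0 ≤ crossForm e₁ p := by
    intro p hp
    by_cases h0 : p = 0
    · simp [h0]
    · exact hslope _ h₁ _ ((hmem p).2 ⟨hp, h0⟩) (hmin p ((hmem p).2 ⟨hp, h0⟩))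
  have H₂ : ∀ p ∈ F.points, crossForm e₂ p ≤ 0 := by
    intro p hp
    by_cases h0 : p = 0
    · simp [h0]
    · have := hslope _ ((hmem p).2 ⟨hp, h0⟩) _ h₂ (hmax p ((hmem p).2 ⟨hp, h0⟩))
      simp only [crossForm_apply] at this ⊢
      linarith
  have e₁p := ((hmem _).1 h₁).1
  have e₂p := ((hmem _).1 h₂).1
  refine ⟨e₁, e₁p, e₂, e₂p, H₁, H₂, (H₁ e₂ e₂p).lt_of_ne fun h0 => ?_⟩
  -- If `e₁` and `e₂` were parallel, all points would lie on their common line, contrary to the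
  -- nonempty interior.
  obtain ⟨p, hp, hp0⟩ := F.exists_form_ne (crossForm_ne_zero ((hmem _).1 h₁).2) 0
  have a := (H₁ p hp).lt_of_ne' hp0
  have b := H₂ p hp
  have s₁ := hpos _ h₁
  have s₂ := hpos _ h₂
  simp only [crossForm_apply] at a b h0
  have key : (e₁.1 + e₁.2) * (e₂.1 * p.2 - e₂.2 * p.1) =
      (e₂.1 + e₂.2) * (e₁.1 * p.2 - e₁.2 * p.1) := by linear_combination (p.1 + p.2) * h0
  nlinarith [mul_pos s₂ a, mul_nonneg s₁.le (neg_nonneg.2 b)]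

theorem mem_span_iff_crossForm {e x : ℝ × ℝ} (he : e ≠ 0) :
    x ∈ Submodule.span ℝ {e} ↔ crossForm e x = 0 := by
  rw [Submodule.mem_span_singleton, crossForm_apply]
  constructor
  · rintro ⟨c, rfl⟩
    simp
    ring
  · intro h
    rcases eq_or_ne e.1 0 with h1 | h1
    · have h2 : e.2 ≠ 0 := fun h2 => he (Prod.ext h1 h2)
      refine ⟨x.2 / e.2, Prod.ext ?_ ?_⟩
      · simp only [Prod.smul_fst, smul_eq_mul, h1, mul_zero]
        rw [h1, zero_mul, zero_sub, neg_eq_zero] at h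
        exact ((mul_eq_zero.1 h).resolve_left h2).symm
      · simp [h2]
    · refine ⟨x.1 / e.1, Prod.ext ?_ ?_⟩
      · simp [h1]
      · simp only [Prod.smul_snd, smul_eq_mul]
        field_simp
        linarith

theorem rationalCone_form_nonneg {f : ℝ × ℝ →ₗ[ℝ] ℝ} (h : ∀ p ∈ F.points, 0 ≤ f p)
    {z : ℝ × ℝ} (hz : z ∈ rationalCone F.body) : 0 ≤ f z := by
  refine Submodule.span_induction (p := fun x _ => 0 ≤ f x) ?_ ?_ ?_ ?_ hz
  · exact fun x hx => form_nonneg h hx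
  · simp
  · intro x y _ _ hx hy
    rw [map_add]
    exact add_nonneg hx hy
  · intro q x _ hx
    have : q • x = ((q : ℚ) : ℝ) • x := rfl
    rw [this, map_smul]
    exact mul_nonneg (by exact_mod_cast q.2) hx

/-- The form supports the cone along the ray: two nonnegative values with sum zero both vanish. -/
theorem isExtremalRay_of_form {e : ℝ × ℝ} (he : e ∈ F.body) (he0 : e ≠ 0) {f : ℝ × ℝ →ₗ[ℝ] ℝ}
    (hf : ∀ p ∈ F.points, 0 ≤ f p) (hfe : ∀ x, x ∈ Submodule.span ℝ {e} ↔ f x = 0) :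
    IsExtremalRay (rationalCone F.body) (Submodule.span ℝ {e}) := by
  refine ⟨finrank_span_singleton he0, ⟨e, Submodule.subset_span he,
    Submodule.mem_span_singleton_self e, he0⟩, fun x hx y hy hxy => ?_⟩
  have hx' := rationalCone_form_nonneg hf hx
  have hy' := rationalCone_form_nonneg hf hy
  rw [hfe, map_add] at hxy
  rw [hfe, hfe]
  constructor <;> linarith

/-- The cone of a polygon has exactly two extremal rays. -/
theorem isExtremalRay_iff {e₁ e₂ : ℝ × ℝ} (h₁ : e₁ ∈ F.points) (h₂ : e₂ ∈ F.points)
    (H₁ : ∀ p ∈ F.points, 0 ≤ crossForm e₁ p) (H₂ : ∀ p ∈ F.points, crossForm e₂ p ≤ 0)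
    (hD : 0 < crossForm e₁ e₂) (τ : Submodule ℝ (ℝ × ℝ)) :
    IsExtremalRay (rationalCone F.body) τ ↔
      τ = Submodule.span ℝ {e₁} ∨ τ = Submodule.span ℝ {e₂} := by
  have he₁ : e₁ ≠ 0 := by rintro rfl; simp at hD
  have he₂ : e₂ ≠ 0 := by rintro rfl; simp at hD
  have H₂' : ∀ p ∈ F.points, 0 ≤ (-crossForm e₂) p := fun p hp => by
    rw [LinearMap.neg_apply]
    exact neg_nonneg.2 (H₂ p hp)
  constructor
  · rintro ⟨hfin, ⟨x, hxC, hxτ, hx0⟩, hsum⟩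
    have hτ : τ = Submodule.span ℝ {x} := by
      refine (Submodule.eq_of_le_of_finrank_eq ?_ ?_).symm
      · simpa using hxτ
      · rw [finrank_span_singleton hx0, hfin]
    have hspan : ∀ e : ℝ × ℝ, e ≠ 0 → crossForm e x = 0 → τ = Submodule.span ℝ {e} := by
      intro e he h
      rw [hτ]
      refine Submodule.eq_of_le_of_finrank_eq ?_ ?_
      · rw [Submodule.span_singleton_le_iff_mem]
        exact (mem_span_iff_crossForm he).2 h
      · rw [finrank_span_singleton hx0, finrank_span_singleton he]
    -- Otherwise the line crosses the segment `e₁ e₂` at an inner point, which is the midpoint of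
    -- two points of `F` off the line. The cone admits only rational scalars, so the two summands
    -- are taken in `F` itself.
    by_contra! hcon
    have hb : 0 < crossForm e₁ x :=
      (rationalCone_form_nonneg H₁ hxC).lt_of_ne' fun h => hcon.1 (hspan _ he₁ h)
    have ha : 0 < -crossForm e₂ x :=
      (rationalCone_form_nonneg H₂' hxC).lt_of_ne' fun h =>
        hcon.2 (hspan _ he₂ (neg_eq_zero.1 h))
    set a := -crossForm e₂ x with ha'
    set b := crossForm e₁ x with hb'
    have hx : crossForm e₁ e₂ • x = a • e₁ + b • e₂ := by
      ext <;> simp [ha', hb'] <;> ring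
    set t := a / (a + b) with ht
    have hab : 0 < a + b := by positivity
    have ht0 : 0 < t := by positivity
    have ht1 : t < 1 := by rw [ht, div_lt_one hab]; linarith
    have hmem : ∀ s : ℝ, 0 ≤ s → s ≤ 1 → s • e₁ + (1 - s) • e₂ ∈ F.body := fun s h0 h1 =>
      F.convex_body (F.mem_body_of_mem_points h₁) (F.mem_body_of_mem_points h₂) h0
        (by linarith) (by ring)
    -- This choice keeps `t + δ = 1 - (1 - t)²` and `t - δ = t²` in the unit interval.
    set δ := t * (1 - t) with hδ
    have hδ0 : 0 < δ := mul_pos ht0 (by linarith)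
    have hy := hmem (t + δ) (by positivity) (by nlinarith)
    have hy' := hmem (t - δ) (by nlinarith) (by nlinarith)
    have hmid : ((t + δ) • e₁ + (1 - (t + δ)) • e₂) + ((t - δ) • e₁ + (1 - (t - δ)) • e₂) =
        (2 * crossForm e₁ e₂ / (a + b)) • x := by
      have h1 : (2 * crossForm e₁ e₂ / (a + b)) • x = (2 / (a + b)) • (crossForm e₁ e₂ • x) := by
        rw [smul_smul]
        congr 1
        ring
      have h2 : 1 - t = b / (a + b) := by
        rw [ht]
        field_simp
        ring
      have h3 : (2 / (a + b)) * a = 2 * t := by rw [ht]; ring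
      have h4 : (2 / (a + b)) * b = 2 * (1 - t) := by rw [h2]; ring
      rw [h1, hx, smul_add, smul_smul, smul_smul, h3, h4]
      module
    have hτy := (hsum _ (Submodule.subset_span hy) _ (Submodule.subset_span hy')
      (by rw [hmid]; exact τ.smul_mem _ hxτ)).1
    have hτmid : t • e₁ + (1 - t) • e₂ ∈ τ := by
      have : t • e₁ + (1 - t) • e₂ = (crossForm e₁ e₂ / (a + b)) • x := by
        have h := congrArg (fun z => (1 / 2 : ℝ) • z) hmid
        simp only [smul_smul] at h
        rw [show (1 / 2 * (2 * crossForm e₁ e₂ / (a + b))) = crossForm e₁ e₂ / (a + b) by ring]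
          at h
        rw [← h]
        module
      rw [this]
      exact τ.smul_mem _ hxτ
    have hdiff : e₁ - e₂ ∈ τ := by
      have h := τ.smul_mem δ⁻¹ (τ.sub_mem hτy hτmid)
      have : δ⁻¹ • (((t + δ) • e₁ + (1 - (t + δ)) • e₂) - (t • e₁ + (1 - t) • e₂)) =
          (δ⁻¹ * δ) • (e₁ - e₂) := by module
      rwa [this, inv_mul_cancel₀ hδ0.ne', one_smul] at h
    -- The left side equals `-(a + b)`, which is negative.
    have hmul := (mem_span_iff_crossForm hx0).1 (hτ ▸ hdiff)
    simp only [crossForm_apply] at hmul ha' hb'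
    simp only [Prod.fst_sub, Prod.snd_sub] at hmul
    nlinarith
  · rintro (rfl | rfl)
    · exact isExtremalRay_of_form (F.mem_body_of_mem_points h₁) he₁ H₁
        fun x => mem_span_iff_crossForm he₁
    · refine isExtremalRay_of_form (F.mem_body_of_mem_points h₂) he₂ H₂' fun x => ?_
      rw [mem_span_iff_crossForm he₂, LinearMap.neg_apply, neg_eq_zero]

/-! ### Finite generation forces rational points -/

/-- If the semigroup is finitely generated, then every edge of the cone contains a rational point
of the polygon. -/
theorem exists_rational_of_fg (hfg : F.semigroup.FG) {f : ℝ × ℝ →ₗ[ℝ] ℝ}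
    (hf : ∀ p ∈ F.points, 0 ≤ f p) {e : ℝ × ℝ} (he : e ∈ F.body) (he0 : e ≠ 0) (hfe : f e = 0) :
    ∃ a b : ℚ, (a, b) ≠ (0, 0) ∧ ((a : ℝ), (b : ℝ)) ∈ F.body ∧ f ((a : ℝ), (b : ℝ)) = 0 := by
  obtain ⟨G, hG⟩ := hfg
  by_cases hex : ∃ g ∈ G, g ≠ 0 ∧ f (natPoint g) = 0
  · obtain ⟨g, hg, hg0, hfg⟩ := hex
    obtain ⟨i, z, hz, hzg⟩ := F.mem_semigroup.1 (hG ▸ AddSubmonoid.subset_closure hg)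
    dsimp only at hzg
    have hi : (i : ℝ) ≠ 0 := by
      rintro hi
      rw [hi, zero_smul] at hzg
      refine hg0 (Prod.ext ?_ ?_)
      · simpa using (congrArg Prod.fst hzg).symm
      · simpa using (congrArg Prod.snd hzg).symm
    have hz' : (((g.1 / i : ℚ) : ℝ), ((g.2 / i : ℚ) : ℝ)) = z := by
      have : z = (i : ℝ)⁻¹ • natPoint g := by rw [← hzg, inv_smul_smul₀ hi]
      rw [this]
      ext <;> simp <;> field_simp
    refine ⟨g.1 / i, g.2 / i, ?_, ?_, ?_⟩
    · intro h
      have hi' : (i : ℚ) ≠ 0 := by exact_mod_cast hi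
      simp only [Prod.mk.injEq, div_eq_zero_iff, hi', or_false, Nat.cast_eq_zero] at h
      exact hg0 (Prod.ext h.1 h.2)
    · rw [hz']
      exact hz
    · rw [hz']
      rw [← hzg, map_smul, smul_eq_mul] at hfg
      exact (mul_eq_zero.1 hfg).resolve_left hi
  · exfalso
    push Not at hex
    have hsemi : ∀ x ∈ F.semigroup, 0 ≤ f (natPoint x) := by
      rintro x ⟨i, z, hz, hzx⟩
      dsimp only at hzx
      rw [natPoint_apply, ← hzx, map_smul]
      exact mul_nonneg (Nat.cast_nonneg i) (form_nonneg hf hz)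
    -- Finitely many generators, with `f` positive on each nonzero one, give a uniform constant;
    -- additivity carries the bound over to the whole semigroup.
    obtain ⟨c, hc, hcG⟩ : ∃ c : ℝ, 0 < c ∧
        ∀ g ∈ G, c * ((g.1 : ℝ) + g.2) ≤ f (natPoint g) := by
      have hall : ∀ g ∈ G, ∃ c : ℝ, 0 < c ∧ c * ((g.1 : ℝ) + g.2) ≤ f (natPoint g) := by
        intro g hg
        by_cases hg0 : g = 0
        · exact ⟨1, one_pos, by rw [hg0, map_zero, map_zero]; simp⟩
        · have h1 : 0 < f (natPoint g) := (hsemi g (hG ▸ AddSubmonoid.subset_closure hg)).lt_of_ne'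
            (hex g hg hg0)
          refine ⟨f (natPoint g) / ((g.1 : ℝ) + g.2 + 1), by positivity, ?_⟩
          rw [div_mul_eq_mul_div, div_le_iff₀ (by positivity)]
          nlinarith
      choose! c hc hc' using hall
      rcases G.eq_empty_or_nonempty with rfl | hne
      · exact ⟨1, one_pos, by simp⟩
      · obtain ⟨g₀, hg₀, hmin⟩ := G.exists_min_image c hne
        refine ⟨c g₀, hc g₀ hg₀, fun g hg => le_trans ?_ (hc' g hg)⟩
        exact mul_le_mul_of_nonneg_right (hmin g hg) (by positivity)
    have hcS : ∀ x ∈ F.semigroup, c * ((x.1 : ℝ) + x.2) ≤ f (natPoint x) := by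
      intro x hx
      rw [← hG] at hx
      refine AddSubmonoid.closure_induction (motive := fun x _ => c * ((x.1 : ℝ) + x.2) ≤
        f (natPoint x)) (fun g hg => hcG g hg) (by rw [map_zero, map_zero]; simp) ?_ hx
      intro x y _ _ hx hy
      rw [map_add, map_add]
      push_cast [Prod.fst_add, Prod.snd_add]
      linarith
    -- The opposite strict inequality holds at `e`, hence at interior points of the polygon near
    -- `e`, among them a rational one; clearing denominators gives an element of the semigroup.
    have hopen : IsOpen {z : ℝ × ℝ | f z < c * (z.1 + z.2)} :=
      isOpen_lt f.continuous_of_finiteDimensional (by fun_prop)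
    have hmem : e ∈ closure (interior F.body) := by
      rw [F.convex_body.closure_interior_eq_closure_of_nonempty_interior F.interior_nonempty]
      exact subset_closure he
    have hpos := add_pos_of_ne_zero (fst_nonneg he) (snd_nonneg he) he0
    have hne := mem_closure_iff.1 hmem _ hopen (by
      change f e < c * (e.1 + e.2)
      rw [hfe]
      positivity)
    have hdense : DenseRange (Prod.map ((↑) : ℚ → ℝ) ((↑) : ℚ → ℝ)) :=
      Rat.denseRange_cast.prodMap Rat.denseRange_cast
    obtain ⟨⟨a, b⟩, hlt, hab⟩ := hdense.exists_mem_open (hopen.inter isOpen_interior) hne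
    have hab : ((a : ℝ), (b : ℝ)) ∈ F.body := interior_subset hab
    have hlt : f ((a : ℝ), (b : ℝ)) < c * (a + b) := hlt
    have ha : (0 : ℝ) ≤ a := fst_nonneg hab
    have hb : (0 : ℝ) ≤ b := snd_nonneg hab
    rw [Rat.cast_nonneg] at ha hb
    lift a to ℚ≥0 using ha
    lift b to ℚ≥0 using hb
    have hx : natPoint (a.num * b.den, b.num * a.den) =
        ((a.den * b.den : ℕ) : ℝ) • (((a : ℚ) : ℝ), ((b : ℚ) : ℝ)) := by
      have h1 : ((a : ℚ) : ℝ) * a.den = a.num := by exact_mod_cast NNRat.mul_den_eq_num a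
      have h2 : ((b : ℚ) : ℝ) * b.den = b.num := by exact_mod_cast NNRat.mul_den_eq_num b
      ext
      · simp only [natPoint_apply, Prod.smul_mk, smul_eq_mul]
        push_cast
        linear_combination (-(b.den : ℝ)) * h1
      · simp only [natPoint_apply, Prod.smul_mk, smul_eq_mul]
        push_cast
        linear_combination (-(a.den : ℝ)) * h2
    have hS : (a.num * b.den, b.num * a.den) ∈ F.semigroup :=
      F.mem_semigroup.2 ⟨a.den * b.den, by rw [hx]; exact Set.smul_mem_smul_set hab⟩
    have h := hcS _ hS
    have h1 := congrArg Prod.fst hx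
    have h2 := congrArg Prod.snd hx
    simp only [natPoint_apply, Prod.smul_mk, smul_eq_mul] at h1 h2
    rw [hx, map_smul, h1, h2, smul_eq_mul] at h
    have hd : (0 : ℝ) < ((a.den * b.den : ℕ) : ℝ) := by
      exact_mod_cast Nat.mul_pos a.den_pos b.den_pos
    nlinarith [mul_lt_mul_of_pos_left hlt hd]

end ConvexPolygon

/-! ### Multiples of a convex set -/

/-- Iterates `(a + b) • s = a • s + b • s`, valid for convex `s` and `a, b ≥ 0`. -/
theorem Convex.sum_smul_mem_smul {E ι : Type*} [AddCommGroup E] [Module ℝ E] {s : Set E}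
    (hs : Convex ℝ s) (hne : s.Nonempty) (T : Finset ι) (c : ι → ℝ) (z : ι → E)
    (hc : ∀ p ∈ T, 0 ≤ c p) (hz : ∀ p ∈ T, z p ∈ s) :
    ∑ p ∈ T, c p • z p ∈ (∑ p ∈ T, c p) • s := by
  classical
  induction T using Finset.induction_on with
  | empty => simp [Set.zero_smul_set hne]
  | insert a T ha ih =>
    rw [Finset.sum_insert ha, Finset.sum_insert ha,
      hs.add_smul (hc a (Finset.mem_insert_self a T))
        (Finset.sum_nonneg fun p hp => hc p (Finset.mem_insert_of_mem hp))]
    exact Set.add_mem_add (Set.smul_mem_smul_set (hz a (Finset.mem_insert_self a T)))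
      (ih (fun p hp => hc p (Finset.mem_insert_of_mem hp))
        fun p hp => hz p (Finset.mem_insert_of_mem hp))

/-- Writing `x = u x + v x` with `u + v = 1`, and `x` as an element of `a • s` and of `b • s`, puts
it into `(u a + v b) • s`: the admissible indices form an interval. -/
theorem Convex.mem_smul_of_mem_Icc {E : Type*} [AddCommGroup E] [Module ℝ E] {s : Set E}
    (hs : Convex ℝ s) {x : E} {a b t : ℝ} (ha : 0 ≤ a) (hxa : x ∈ a • s) (hxb : x ∈ b • s)
    (ht : t ∈ Set.Icc a b) : x ∈ t • s := by
  have hb : 0 ≤ b := ha.trans (ht.1.trans ht.2)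
  rw [← segment_eq_Icc (ht.1.trans ht.2)] at ht
  obtain ⟨u, v, hu, hv, huv, rfl⟩ := ht
  rw [smul_eq_mul, smul_eq_mul, hs.add_smul (mul_nonneg hu ha) (mul_nonneg hv hb), mul_smul, mul_smul]
  have := Set.add_mem_add (Set.smul_mem_smul_set (a := u) hxa) (Set.smul_mem_smul_set (a := v) hxb)
  rwa [← add_smul, huv, one_smul] at this

/-! ### Coordinates along the extremal rays -/

namespace ConvexPolygon

/-- Two points `P`, `Q` of the polygon span the extremal rays of its cone, `α` and `β` are the
coordinates with respect to them, and the points that present the polygon keep, unless they lie on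
the line `PQ`, a certain distance from it. -/
structure IsFrame (F : ConvexPolygon) (α β : ℝ × ℝ →ₗ[ℝ] ℝ) (P Q : ℝ × ℝ) (K : ℝ) : Prop where
  left_mem : P ∈ F.body
  right_mem : Q ∈ F.body
  left_left : α P = 1
  right_left : β P = 0
  left_right : α Q = 0
  right_right : β Q = 1
  decomp : ∀ x, α x • P + β x • Q = x
  left_nonneg : ∀ p ∈ F.points, 0 ≤ α p
  right_nonneg : ∀ p ∈ F.points, 0 ≤ β p
  gap : ∀ p ∈ F.points, α p + β p = 1 ∨ 1 ≤ K * |1 - (α p + β p)|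

namespace IsFrame

variable {F : ConvexPolygon} {α β : ℝ × ℝ →ₗ[ℝ] ℝ} {P Q : ℝ × ℝ} {K : ℝ}

theorem swap (h : F.IsFrame α β P Q K) : F.IsFrame β α Q P K where
  left_mem := h.right_mem
  right_mem := h.left_mem
  left_left := h.right_right
  right_left := h.left_right
  left_right := h.right_left
  right_right := h.left_left
  decomp x := by rw [add_comm]; exact h.decomp x
  left_nonneg := h.right_nonneg
  right_nonneg := h.left_nonneg
  gap p hp := by rw [add_comm]; exact h.gap p hp

/-- Combinations of `P` and `Q` alone already reach `x`; this gives every point of the cone a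
canonical real index. -/
theorem mem_smul (h : F.IsFrame α β P Q K) {x : ℝ × ℝ} (hα : 0 ≤ α x) (hβ : 0 ≤ β x) :
    x ∈ (α x + β x) • F.body := by
  have := Set.add_mem_add (Set.smul_mem_smul_set (a := α x) h.left_mem)
    (Set.smul_mem_smul_set (a := β x) h.right_mem)
  rwa [h.decomp, ← F.convex_body.add_smul hα hβ] at this

theorem nonneg_of_mem_smul (h : F.IsFrame α β P Q K) {x : ℝ × ℝ} {j : ℝ} (hj : 0 ≤ j)
    (hx : x ∈ j • F.body) : 0 ≤ α x := by
  obtain ⟨z, hz, rfl⟩ := hx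
  dsimp only
  rw [map_smul]
  exact mul_nonneg hj (form_nonneg h.left_nonneg hz)

/-- If `x` lies in some multiple of the polygon, it lies in one whose index is close to
`α x + β x`. -/
theorem exists_index (h : F.IsFrame α β P Q K) {x : ℝ × ℝ} {j : ℕ}
    (hx : x ∈ (j : ℝ) • F.body) :
    ∃ i : ℕ, |(i : ℝ) - (α x + β x)| ≤ 1 ∧ (∀ J : ℕ, α x + β x ≤ J → i ≤ J) ∧
      x ∈ (i : ℝ) • F.body := by
  have hα := h.nonneg_of_mem_smul (Nat.cast_nonneg j) hx
  have hβ := h.swap.nonneg_of_mem_smul (Nat.cast_nonneg j) hx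
  have hs : 0 ≤ α x + β x := add_nonneg hα hβ
  -- The point lies in the multiples of index `j` and of index `α x + β x`, hence in all between
  -- them; the latter number is rounded towards `j`.
  rcases le_total (j : ℝ) (α x + β x) with hle | hle
  · refine ⟨⌊α x + β x⌋₊, ?_, fun J hJ => ?_, F.convex_body.mem_smul_of_mem_Icc
      (Nat.cast_nonneg j) hx (h.mem_smul hα hβ) ⟨?_, Nat.floor_le hs⟩⟩
    · rw [abs_le]
      constructor <;> linarith [Nat.floor_le hs, Nat.lt_floor_add_one (α x + β x)]
    · exact_mod_cast (Nat.floor_le hs).trans hJ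
    · exact_mod_cast Nat.le_floor hle
  · refine ⟨⌈α x + β x⌉₊, ?_, fun J hJ => Nat.ceil_le.2 hJ, F.convex_body.mem_smul_of_mem_Icc
      hs (h.mem_smul hα hβ) hx ⟨Nat.le_ceil _, ?_⟩⟩
    · rw [abs_le]
      constructor <;> linarith [Nat.le_ceil (α x + β x), Nat.ceil_lt_add_one hs]
    · exact_mod_cast Nat.ceil_le.2 hle

/-- A point with a large first coordinate can be shortened along the first edge of the cone. -/
theorem sub_mem_smul (h : F.IsFrame α β P Q K) (hK : 0 ≤ K) {x : ℝ × ℝ} {j d : ℝ} (hj : 0 ≤ j)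
    (hx : x ∈ j • F.body) (hjs : |j - (α x + β x)| ≤ 1) (hd : d + (K + 1) ≤ α x) :
    0 ≤ j - d ∧ x - d • P ∈ (j - d) • F.body := by
  classical
  obtain ⟨z, hz, rfl⟩ := hx
  dsimp only at *
  have hz' : z ∈ convexHull ℝ (F.points.toFinset : Set (ℝ × ℝ)) := by
    simpa [body] using hz
  obtain ⟨w, hw0, hw1, hwz⟩ := Finset.mem_convexHull'.1 hz'
  set T := F.points.toFinset
  have hT : ∀ p ∈ T, p ∈ F.points := fun p hp => List.mem_toFinset.1 hp
  set σ : ℝ × ℝ →ₗ[ℝ] ℝ := α + β with hσ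
  have hσ' : ∀ x, α x + β x = σ x := fun _ => rfl
  set x := j • z with hxdef
  have hx : ∑ p ∈ T, (j * w p) • p = x := by
    simp_rw [mul_smul]
    rw [← Finset.smul_sum, hwz]
  have hjsum : ∑ p ∈ T, j * w p = j := by rw [← Finset.mul_sum, hw1, mul_one]
  have hc : ∀ p ∈ T, 0 ≤ j * w p := fun p hp => mul_nonneg hj (hw0 p hp)
  have hx' : x ∈ j • F.body := Set.smul_mem_smul_set hz
  have hβx := h.swap.nonneg_of_mem_smul hj hx'
  -- It suffices to find a part `y` of bounded `α` that carries the whole excess `j - σ x`. What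
  -- remains, `x - d P - y`, then has nonnegative coordinates, so it lies in the multiple whose
  -- index is its `σ`, and the two indices add up to `j - d`.
  have conclude : ∀ (y : ℝ × ℝ) (r : ℝ), 0 ≤ r → y ∈ r • F.body → α y ≤ K + 1 → β y ≤ β x →
      r - σ y = j - σ x → 0 ≤ j - d ∧ x - d • P ∈ (j - d) • F.body := by
    intro y r hr hy hαy hβy hrs
    have hα' : α (x - d • P - y) = α x - d - α y := by simp [h.left_left]
    have hβ' : β (x - d • P - y) = β x - β y := by simp [h.right_left]
    have hα0 : 0 ≤ α (x - d • P - y) := by rw [hα']; linarith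
    have hβ0 : 0 ≤ β (x - d • P - y) := by rw [hβ']; linarith
    have hsum : r + (α (x - d • P - y) + β (x - d • P - y)) = j - d := by
      rw [hα', hβ']
      rw [hσ, LinearMap.add_apply, LinearMap.add_apply] at hrs
      linarith
    have hmem := Set.add_mem_add hy (h.mem_smul hα0 hβ0)
    rw [← F.convex_body.add_smul hr (by positivity), hsum, add_sub_cancel] at hmem
    exact ⟨by linarith, hmem⟩
  -- `ε` is the sign of the excess, so that both signs are treated at once.
  obtain ⟨ε, hε, hεt⟩ : ∃ ε : ℝ, ε * ε = 1 ∧ ε * (j - σ x) = |j - σ x| := by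
    rcases le_total 0 (j - σ x) with h0 | h0
    · exact ⟨1, by norm_num, by rw [abs_of_nonneg h0, one_mul]⟩
    · exact ⟨-1, by norm_num, by rw [abs_of_nonpos h0]; ring⟩
  set t := |j - σ x| with ht
  have htsum : ∑ p ∈ T, (j * w p) * (ε * (1 - σ p)) = t := by
    rw [← hεt, ← hx, map_sum]
    nth_rewrite 2 [← hjsum]
    rw [← Finset.sum_sub_distrib, Finset.mul_sum]
    refine Finset.sum_congr rfl fun p _ => ?_
    rw [map_smul, smul_eq_mul]
    ring
  rcases (abs_nonneg (j - σ x)).eq_or_lt with h0 | h0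
  · refine conclude 0 0 le_rfl (by simp [Set.zero_smul_set F.nonempty_body]) ?_ ?_ ?_
    · rw [map_zero]
      linarith
    · rwa [map_zero]
    · rw [map_zero, abs_eq_zero.1 h0.symm, sub_zero]
  -- Only the points whose deviation `1 - σ p` has the sign of the excess are kept. Their total
  -- deviation `c` is at least `t`, and scaling their weights by `t / c` makes it exactly `t`.
  · set T' := T.filter fun p => 0 < ε * (1 - σ p) with hT'
    have hsub : T' ⊆ T := Finset.filter_subset _ _
    set c := ∑ p ∈ T', (j * w p) * (ε * (1 - σ p)) with hcdef
    have htc : t ≤ c := by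
      rw [← htsum, hcdef, hT', Finset.sum_filter]
      refine Finset.sum_le_sum fun p hp => ?_
      split_ifs with hpos
      · exact le_rfl
      · exact mul_nonpos_of_nonneg_of_nonpos (hc p hp) (not_lt.1 hpos)
    have hc0 : 0 < c := h0.trans_le htc
    set l := t / c with hl
    have hl0 : 0 ≤ l := div_nonneg h0.le hc0.le
    have hl1 : l ≤ 1 := (div_le_one hc0).2 htc
    have hlc : l * c = t := div_mul_cancel₀ t hc0.ne'
    have hc' : ∀ p ∈ T', 0 ≤ l * (j * w p) := fun p hp => mul_nonneg hl0 (hc p (hsub hp))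
    refine conclude (∑ p ∈ T', (l * (j * w p)) • p) (∑ p ∈ T', l * (j * w p))
      (Finset.sum_nonneg hc') (F.convex_body.sum_smul_mem_smul F.nonempty_body T' _ _ hc'
        fun p hp => F.mem_body_of_mem_points (hT p (hsub hp))) ?_ ?_ ?_
    -- Here `α p ≤ σ p ≤ 1 + |1 - σ p|`, and the gap condition bounds the `1` by `K |1 - σ p|`.
    · have hbound : ∀ p ∈ T', α p ≤ (K + 1) * (ε * (1 - σ p)) := by
        intro p hp
        have hpos : 0 < ε * (1 - σ p) := (Finset.mem_filter.1 hp).2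
        have habs : |1 - σ p| = ε * (1 - σ p) := by
          have hε1 : |ε| = 1 := by
            have : |ε| * |ε| = 1 := by rw [← abs_mul, hε, abs_one]
            nlinarith [abs_nonneg ε]
          rw [← abs_of_pos hpos, abs_mul, hε1, one_mul]
        have hne : σ p ≠ 1 := by
          intro h1
          rw [h1] at hpos
          simp at hpos
        have hg := (h.gap p (hT p (hsub hp))).resolve_left hne
        rw [hσ' p, habs] at hg
        have h1 : σ p ≤ 1 + ε * (1 - σ p) := by
          rw [← habs]
          linarith [neg_abs_le (1 - σ p)]
        have h2 : α p ≤ σ p := by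
          rw [hσ, LinearMap.add_apply]
          linarith [h.right_nonneg p (hT p (hsub hp))]
        linarith
      rw [map_sum]
      calc ∑ p ∈ T', α ((l * (j * w p)) • p)
          ≤ ∑ p ∈ T', (K + 1) * (l * ((j * w p) * (ε * (1 - σ p)))) := by
            refine Finset.sum_le_sum fun p hp => ?_
            rw [map_smul, smul_eq_mul]
            calc l * (j * w p) * α p ≤ l * (j * w p) * ((K + 1) * (ε * (1 - σ p))) :=
                  mul_le_mul_of_nonneg_left (hbound p hp) (hc' p hp)
              _ = _ := by ring
        _ = (K + 1) * t := by rw [← Finset.mul_sum, ← Finset.mul_sum, ← hlc]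
        _ ≤ K + 1 := mul_le_of_le_one_right (by linarith) hjs
    · rw [← hx, map_sum, map_sum]
      refine (Finset.sum_le_sum fun p hp => ?_).trans (Finset.sum_le_sum_of_subset_of_nonneg hsub
        fun p hp _ => ?_)
      · rw [map_smul, map_smul, smul_eq_mul, smul_eq_mul]
        exact mul_le_mul_of_nonneg_right (mul_le_of_le_one_left (hc p (hsub hp)) hl1)
          (h.right_nonneg p (hT p (hsub hp)))
      · rw [map_smul]
        exact mul_nonneg (hc p hp) (h.right_nonneg p (hT p hp))
    · have h1 : ∑ p ∈ T', l * (j * w p) - σ (∑ p ∈ T', (l * (j * w p)) • p) =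
          ε * (ε * ε) * (l * c) := by
        rw [map_sum, ← Finset.sum_sub_distrib, hcdef, Finset.mul_sum, Finset.mul_sum]
        refine Finset.sum_congr rfl fun p _ => ?_
        rw [map_smul, smul_eq_mul]
        linear_combination (-(l * (j * w p) * (1 - σ p)) * (ε * ε + 1)) * hε
      rw [h1, hlc, hε, mul_one, ← hεt, ← mul_assoc, hε, one_mul]

end IsFrame

end ConvexPolygon

/-! ### Lattice frames and the box of generators -/

namespace ConvexPolygon

/-- Lattice points `u`, `v` on the two extremal rays of the cone, both in the `d`-th multiple of
the polygon, together with a bound `K` for how close the points that present the polygon come to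
the line through `u / d` and `v / d` without lying on it. -/
structure IsLatticeFrame (F : ConvexPolygon) (d K : ℕ) (u v : ℕ × ℕ) : Prop where
  pos : 0 < d
  det_pos : u.2 * v.1 < u.1 * v.2
  left_mem : natPoint u ∈ (d : ℝ) • F.body
  right_mem : natPoint v ∈ (d : ℝ) • F.body
  left_nonneg : ∀ p ∈ F.points, v.1 * p.2 ≤ v.2 * p.1
  right_nonneg : ∀ p ∈ F.points, u.2 * p.1 ≤ u.1 * p.2
  gap : ∀ p ∈ F.points,
    d * (v.2 * p.1 + u.1 * p.2) + u.2 * v.1 = u.1 * v.2 + d * (v.1 * p.2 + u.2 * p.1) ∨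
    u.1 * v.2 + K * (d * (v.2 * p.1 + u.1 * p.2) + u.2 * v.1) ≤
      u.2 * v.1 + K * (u.1 * v.2 + d * (v.1 * p.2 + u.2 * p.1)) ∨
    u.1 * v.2 + K * (u.1 * v.2 + d * (v.1 * p.2 + u.2 * p.1)) ≤
      u.2 * v.1 + K * (d * (v.2 * p.1 + u.1 * p.2) + u.2 * v.1)

/-- A bound for the coordinates of the elements of a system of generators. -/
def boxBound (K : ℕ) (u v : ℕ × ℕ) : ℕ := (K + 2) * (u.1 + u.2 + v.1 + v.2)

/-- A bound for the index of a multiple of the polygon that contains a given element of the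
semigroup with bounded coordinates. -/
def indexBound (d K : ℕ) (u v : ℕ × ℕ) : ℕ := d * boxBound K u v * (u.1 + v.2)

namespace IsLatticeFrame

variable {F : ConvexPolygon} {d K : ℕ} {u v : ℕ × ℕ}

theorem natCast_det_pos (h : F.IsLatticeFrame d K u v) : 0 < crossForm (natPoint u) (natPoint v) := by
  have : (u.2 * v.1 : ℝ) < u.1 * v.2 := by exact_mod_cast h.det_pos
  simpa using this

/-- The first coordinate with respect to the frame. -/
noncomputable def leftForm (d : ℕ) (u v : ℕ × ℕ) : ℝ × ℝ →ₗ[ℝ] ℝ :=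
  -(d / crossForm (natPoint u) (natPoint v)) • crossForm (natPoint v)

/-- The second coordinate with respect to the frame. -/
noncomputable def rightForm (d : ℕ) (u v : ℕ × ℕ) : ℝ × ℝ →ₗ[ℝ] ℝ :=
  (d / crossForm (natPoint u) (natPoint v)) • crossForm (natPoint u)

theorem isFrame (h : F.IsLatticeFrame d K u v) :
    F.IsFrame (leftForm d u v) (rightForm d u v)
      ((d : ℝ)⁻¹ • natPoint u) ((d : ℝ)⁻¹ • natPoint v) K := by
  have hd : (0 : ℝ) < d := by exact_mod_cast h.pos
  have hD := h.natCast_det_pos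
  have hdD : 0 < (d : ℝ) / crossForm (natPoint u) (natPoint v) := div_pos hd hD
  have hinv : ∀ {x : ℝ × ℝ}, x ∈ (d : ℝ) • F.body → (d : ℝ)⁻¹ • x ∈ F.body := fun hx =>
    (Set.mem_smul_set_iff_inv_smul_mem₀ hd.ne' _ _).1 hx
  have hα : ∀ x, leftForm d u v x =
      d / crossForm (natPoint u) (natPoint v) * (v.2 * x.1 - v.1 * x.2) := fun x => by
    simp [leftForm]
    ring
  have hβ : ∀ x, rightForm d u v x =
      d / crossForm (natPoint u) (natPoint v) * (u.1 * x.2 - u.2 * x.1) := fun x => by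
    simp [rightForm]
  have hD' : crossForm (natPoint u) (natPoint v) = u.1 * v.2 - u.2 * v.1 := rfl
  refine ⟨hinv h.left_mem, hinv h.right_mem, ?_, ?_, ?_, ?_, fun x => ?_, fun p hp => ?_,
    fun p hp => ?_, fun p hp => ?_⟩
  · rw [hα, hD']
    rw [hD'] at hD
    simp
    field_simp
  · rw [hβ]
    simp
    right; ring
  · rw [hα]
    simp
    right; ring
  · rw [hβ, hD']
    rw [hD'] at hD
    simp
    field_simp
  · rw [hα, hβ, hD']
    rw [hD'] at hD
    ext
    · simp
      field_simp
      ring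
    · simp
      field_simp
      ring
  · rw [hα]
    exact mul_nonneg hdD.le (sub_nonneg.2 (h.left_nonneg p hp))
  · rw [hβ]
    exact mul_nonneg hdD.le (sub_nonneg.2 (h.right_nonneg p hp))
  · have hs : 1 - (leftForm d u v p + rightForm d u v p) =
        (u.1 * v.2 + d * (v.1 * p.2 + u.2 * p.1) - (d * (v.2 * p.1 + u.1 * p.2) + u.2 * v.1)) /
          crossForm (natPoint u) (natPoint v) := by
      rw [hα, hβ, hD']
      rw [hD'] at hD
      field_simp
      ring
    have hs' : |1 - (leftForm d u v p + rightForm d u v p)| =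
        |u.1 * v.2 + d * (v.1 * p.2 + u.2 * p.1) - (d * (v.2 * p.1 + u.1 * p.2) + u.2 * v.1)| /
          crossForm (natPoint u) (natPoint v) := by
      rw [hs, abs_div, abs_of_pos hD]
    rcases h.gap p hp with hg | hg | hg
    · left
      have h0 : 1 - (leftForm d u v p + rightForm d u v p) = 0 := by
        rw [hs, sub_eq_zero.2 hg.symm, zero_div]
      linarith
    · right
      rw [hs', ← mul_div_assoc, one_le_div hD]
      refine le_trans ?_ (mul_le_mul_of_nonneg_left (le_abs_self _) (Nat.cast_nonneg K))
      rw [hD']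
      linarith
    · right
      rw [hs', ← mul_div_assoc, one_le_div hD]
      refine le_trans ?_ (mul_le_mul_of_nonneg_left (neg_le_abs _) (Nat.cast_nonneg K))
      rw [hD']
      linarith

/-- The determinant of `u`, `v` is a positive integer, hence at least `1`, and the negative terms in
the numerator can be dropped. -/
theorem index_le (h : F.IsLatticeFrame d K u v) {x : ℕ × ℕ} (h1 : x.1 ≤ boxBound K u v)
    (h2 : x.2 ≤ boxBound K u v) :
    leftForm d u v (natPoint x) + rightForm d u v (natPoint x) ≤ indexBound d K u v := by
  have hD : (1 : ℝ) ≤ u.1 * v.2 - u.2 * v.1 := by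
    have : (u.2 * v.1 + 1 : ℝ) ≤ u.1 * v.2 := by exact_mod_cast h.det_pos
    linarith
  have hD0 : (0 : ℝ) < u.1 * v.2 - u.2 * v.1 := by linarith
  have heq : leftForm d u v (natPoint x) + rightForm d u v (natPoint x) =
      d * (v.2 * x.1 + u.1 * x.2 - (v.1 * x.2 + u.2 * x.1)) / (u.1 * v.2 - u.2 * v.1) := by
    simp [leftForm, rightForm]
    ring
  rw [heq, div_le_iff₀ hD0]
  have h1' : (x.1 : ℝ) ≤ boxBound K u v := by exact_mod_cast h1
  have h2' : (x.2 : ℝ) ≤ boxBound K u v := by exact_mod_cast h2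
  calc (d : ℝ) * (v.2 * x.1 + u.1 * x.2 - (v.1 * x.2 + u.2 * x.1))
      ≤ d * (v.2 * boxBound K u v + u.1 * boxBound K u v) := by
        refine mul_le_mul_of_nonneg_left ?_ (Nat.cast_nonneg d)
        have := mul_le_mul_of_nonneg_left h1' (Nat.cast_nonneg (α := ℝ) v.2)
        have := mul_le_mul_of_nonneg_left h2' (Nat.cast_nonneg (α := ℝ) u.1)
        have : (0 : ℝ) ≤ v.1 * x.2 + u.2 * x.1 := by positivity
        linarith
    _ = indexBound d K u v := by
        rw [indexBound]
        push_cast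
        ring
    _ ≤ indexBound d K u v * (u.1 * v.2 - u.2 * v.1) :=
        le_mul_of_one_le_right (Nat.cast_nonneg _) hD

/-- An element of the semigroup is contained in a multiple of the polygon of bounded index. -/
theorem exists_index_le (h : F.IsLatticeFrame d K u v) {x : ℕ × ℕ} (hx : x ∈ F.semigroup)
    (h1 : x.1 ≤ boxBound K u v) (h2 : x.2 ≤ boxBound K u v) :
    ∃ i ≤ indexBound d K u v, natPoint x ∈ (i : ℝ) • F.body := by
  obtain ⟨j, hj⟩ := F.mem_semigroup.1 hx
  obtain ⟨i, _, hi, hxi⟩ := h.isFrame.exists_index hj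
  exact ⟨i, hi _ (h.index_le h1 h2), hxi⟩

/-- The descent step on lattice points. It is stated for an arbitrary frame so that it serves both
rays, through `IsFrame.swap`. -/
theorem exists_sub_mem {α β : ℝ × ℝ →ₗ[ℝ] ℝ} {P Q : ℝ × ℝ} (h : F.IsFrame α β P Q K)
    {x w : ℕ × ℕ} (hx : x ∈ F.semigroup) (hw : natPoint w = (d : ℝ) • P)
    (hα : d + (K + 1) ≤ α (natPoint x)) : ∃ y ∈ F.semigroup, x = y + w := by
  obtain ⟨j, hj⟩ := F.mem_semigroup.1 hx
  obtain ⟨i, hi, _, hxi⟩ := h.exists_index hj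
  obtain ⟨hid, hmem⟩ := h.sub_mem_smul (Nat.cast_nonneg K) (Nat.cast_nonneg i) hxi hi hα
  have hdi : d ≤ i := by exact_mod_cast sub_nonneg.1 hid
  rw [← hw] at hmem
  obtain ⟨z, hz, hzx⟩ := hmem
  dsimp only at hzx
  have hle : ∀ {a b : ℕ} {t : ℝ}, 0 ≤ t → (i - d : ℝ) * t = a - b → b ≤ a := by
    intro a b t ht hab
    have : (0 : ℝ) ≤ a - b := hab ▸ mul_nonneg hid ht
    exact_mod_cast sub_nonneg.1 this
  have h1 : w.1 ≤ x.1 := hle (fst_nonneg hz) (congrArg Prod.fst hzx)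
  have h2 : w.2 ≤ x.2 := hle (snd_nonneg hz) (congrArg Prod.snd hzx)
  refine ⟨(x.1 - w.1, x.2 - w.2), F.mem_semigroup.2 ⟨i - d, z, hz, ?_⟩, ?_⟩
  · dsimp only
    rw [Nat.cast_sub hdi, hzx]
    ext <;> simp [h1, h2]
  · ext
    · simp [h1]
    · simp [h2]

/-- The semigroup is generated by its elements with bounded coordinates. -/
theorem mem_closure (h : F.IsLatticeFrame d K u v) {x : ℕ × ℕ} (hx : x ∈ F.semigroup) :
    x ∈ AddSubmonoid.closure
      {y | y ∈ F.semigroup ∧ y.1 ≤ boxBound K u v ∧ y.2 ≤ boxBound K u v} := by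
  have hd : (0 : ℝ) < d := by exact_mod_cast h.pos
  have hd1 : (1 : ℝ) ≤ d := by exact_mod_cast h.pos
  have hF := h.isFrame
  have hscale : ∀ w : ℝ × ℝ, w = (d : ℝ) • (d : ℝ)⁻¹ • w := fun w => (smul_inv_smul₀ hd.ne' w).symm
  have hbox : ∀ a ≤ u.1 + u.2 + v.1 + v.2, a ≤ boxBound K u v := fun a ha =>
    ha.trans (Nat.le_mul_of_pos_left _ (by omega))
  have hu : u ∈ {y | y ∈ F.semigroup ∧ y.1 ≤ boxBound K u v ∧ y.2 ≤ boxBound K u v} :=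
    ⟨F.mem_semigroup.2 ⟨d, h.left_mem⟩, hbox _ (by omega), hbox _ (by omega)⟩
  have hv : v ∈ {y | y ∈ F.semigroup ∧ y.1 ≤ boxBound K u v ∧ y.2 ≤ boxBound K u v} :=
    ⟨F.mem_semigroup.2 ⟨d, h.right_mem⟩, hbox _ (by omega), hbox _ (by omega)⟩
  have hu0 : 0 < u.1 + u.2 := by
    by_contra! h0
    have := h.det_pos
    rw [show u.1 = 0 by omega, show u.2 = 0 by omega] at this
    simp at this
  have hv0 : 0 < v.1 + v.2 := by
    by_contra! h0
    have := h.det_pos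
    rw [show v.1 = 0 by omega, show v.2 = 0 by omega] at this
    simp at this
  induction hn : x.1 + x.2 using Nat.strong_induction_on generalizing x with
  | _ n ih =>
    subst hn
    by_cases hα : d + (K + 1) ≤ leftForm d u v (natPoint x)
    · obtain ⟨y, hy, rfl⟩ := exists_sub_mem hF hx (hscale _) hα
      exact add_mem (ih (y.1 + y.2) (by simp only [Prod.fst_add, Prod.snd_add]; omega) hy rfl)
        (AddSubmonoid.subset_closure hu)
    by_cases hβ : d + (K + 1) ≤ rightForm d u v (natPoint x)
    · obtain ⟨y, hy, rfl⟩ := exists_sub_mem hF.swap hx (hscale _) hβ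
      exact add_mem (ih (y.1 + y.2) (by simp only [Prod.fst_add, Prod.snd_add]; omega) hy rfl)
        (AddSubmonoid.subset_closure hv)
    -- Both coordinates are now below `d + K + 1`. With respect to `u = d P` and `v = d Q` they are
    -- below `(d + K + 1) / d ≤ K + 2`, which is the factor in `boxBound`.
    have hdec := hF.decomp (natPoint x)
    have hle : ∀ {s t a b : ℝ}, s ≤ d + (K + 1) → t ≤ d + (K + 1) → 0 ≤ a → 0 ≤ b →
        s * ((d : ℝ)⁻¹ * a) + t * ((d : ℝ)⁻¹ * b) ≤ (K + 2) * (a + b) := by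
      intro s t a b hs ht ha hb
      have hlin : ∀ {s : ℝ}, s ≤ d + (K + 1) → s * (d : ℝ)⁻¹ ≤ K + 2 := by
        intro s hs
        rw [← div_eq_mul_inv, div_le_iff₀ hd]
        nlinarith [Nat.cast_nonneg (α := ℝ) K]
      have h1 := mul_le_mul_of_nonneg_right (hlin hs) ha
      have h2 := mul_le_mul_of_nonneg_right (hlin ht) hb
      linarith
    refine AddSubmonoid.subset_closure ⟨hx, ?_, ?_⟩
    · have h1 := congrArg Prod.fst hdec
      simp only [Prod.fst_add, Prod.smul_fst, smul_eq_mul, natPoint_apply] at h1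
      have h2 := hle (not_le.1 hα).le (not_le.1 hβ).le (Nat.cast_nonneg u.1)
        (Nat.cast_nonneg v.1)
      simp only [natPoint_apply] at h2
      rw [h1] at h2
      have h3 : x.1 ≤ (K + 2) * (u.1 + v.1) := by exact_mod_cast h2
      exact h3.trans (Nat.mul_le_mul_left _ (by omega))
    · have h1 := congrArg Prod.snd hdec
      simp only [Prod.snd_add, Prod.smul_snd, smul_eq_mul, natPoint_apply] at h1
      have h2 := hle (not_le.1 hα).le (not_le.1 hβ).le (Nat.cast_nonneg u.2)
        (Nat.cast_nonneg v.2)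
      simp only [natPoint_apply] at h2
      rw [h1] at h2
      have h3 : x.2 ≤ (K + 2) * (u.2 + v.2) := by exact_mod_cast h2
      exact h3.trans (Nat.mul_le_mul_left _ (by omega))

theorem fg (h : F.IsLatticeFrame d K u v) : F.semigroup.FG := by
  have hfin : {y | y ∈ F.semigroup ∧ y.1 ≤ boxBound K u v ∧ y.2 ≤ boxBound K u v}.Finite :=
    (Set.finite_Iic (boxBound K u v, boxBound K u v)).subset fun y hy => hy.2
  refine ⟨hfin.toFinset, le_antisymm (AddSubmonoid.closure_le.2 fun y hy => ?_) fun x hx => ?_⟩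
  · exact (hfin.mem_toFinset.1 hy).1
  · rw [hfin.coe_toFinset]
    exact h.mem_closure hx

end IsLatticeFrame

/-- Two rational points on the extremal rays yield a frame of lattice points. -/
theorem exists_isLatticeFrame {F : ConvexPolygon} {e₁ e₂ : ℝ × ℝ}
    (H₁ : ∀ p ∈ F.points, 0 ≤ crossForm e₁ p) (H₂ : ∀ p ∈ F.points, crossForm e₂ p ≤ 0)
    (he₁ : e₁ ∈ F.points) (he₂ : e₂ ∈ F.points) (hD : 0 < crossForm e₁ e₂)
    (h₁ : HasNonzeroRationalPoint (F.body ∩ (Submodule.span ℝ {e₁} : Submodule ℝ (ℝ × ℝ))))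
    (h₂ : HasNonzeroRationalPoint (F.body ∩ (Submodule.span ℝ {e₂} : Submodule ℝ (ℝ × ℝ)))) :
    ∃ d K u v, F.IsLatticeFrame d K u v := by
  obtain ⟨a₁, b₁, hab₁, hm₁, hs₁⟩ := h₁
  obtain ⟨a₂, b₂, hab₂, hm₂, hs₂⟩ := h₂
  have hpos : ∀ {e : ℝ × ℝ} {a b : ℚ}, e ∈ F.points → (a, b) ≠ (0, 0) →
      ((a : ℝ), (b : ℝ)) ∈ F.body → ((a : ℝ), (b : ℝ)) ∈ Submodule.span ℝ {e} →
      ∃ c : ℝ, 0 < c ∧ c • e = ((a : ℝ), (b : ℝ)) := by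
    intro e a b he hab hm hs
    obtain ⟨c, hc⟩ := Submodule.mem_span_singleton.1 hs
    refine ⟨c, ?_, hc⟩
    by_contra! hc0
    have hne : ((a : ℝ), (b : ℝ)) ≠ 0 := fun h0 => hab (by
      rw [Prod.mk_eq_zero] at h0
      exact Prod.ext (by exact_mod_cast h0.1) (by exact_mod_cast h0.2))
    have := add_pos_of_ne_zero (fst_nonneg hm) (snd_nonneg hm) hne
    rw [← hc] at this
    simp only [Prod.smul_fst, Prod.smul_snd, smul_eq_mul] at this
    nlinarith [(F.nonneg e he).1, (F.nonneg e he).2]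
  obtain ⟨c₁, hc₁, hce₁⟩ := hpos he₁ hab₁ hm₁ hs₁
  obtain ⟨c₂, hc₂, hce₂⟩ := hpos he₂ hab₂ hm₂ hs₂
  have hnn : ∀ {q : ℚ}, (0 : ℝ) ≤ q → 0 ≤ q := fun hq => by exact_mod_cast hq
  have ha₁ := hnn (fst_nonneg hm₁)
  have hb₁ := hnn (snd_nonneg hm₁)
  have ha₂ := hnn (fst_nonneg hm₂)
  have hb₂ := hnn (snd_nonneg hm₂)
  lift a₁ to ℚ≥0 using ha₁
  lift b₁ to ℚ≥0 using hb₁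
  lift a₂ to ℚ≥0 using ha₂
  lift b₂ to ℚ≥0 using hb₂
  have hcast : ∀ q : ℚ≥0, (q.num : ℝ) = ((q : ℚ) : ℝ) * q.den := fun q => by
    exact_mod_cast (NNRat.mul_den_eq_num q).symm
  -- A common denominator of both points, so that one index `d` serves `u` and `v`.
  set d := a₁.den * b₁.den * a₂.den * b₂.den with hd
  have hd0 : 0 < d := by
    have := a₁.den_pos
    have := b₁.den_pos
    have := a₂.den_pos
    have := b₂.den_pos
    positivity
  have hd0' : (0 : ℝ) < d := by exact_mod_cast hd0
  set u : ℕ × ℕ := (a₁.num * b₁.den * a₂.den * b₂.den, a₁.den * b₁.num * a₂.den * b₂.den) with hu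
  set v : ℕ × ℕ := (a₁.den * b₁.den * a₂.num * b₂.den, a₁.den * b₁.den * a₂.den * b₂.num) with hv
  have hu' : natPoint u = (d : ℝ) • (((a₁ : ℚ) : ℝ), ((b₁ : ℚ) : ℝ)) := by
    ext
    · simp only [natPoint_apply, hu, hd, Prod.smul_mk, smul_eq_mul]
      push_cast
      rw [hcast]
      push_cast
      ring
    · simp only [natPoint_apply, hu, hd, Prod.smul_mk, smul_eq_mul]
      push_cast
      rw [hcast]
      push_cast
      ring
  have hv' : natPoint v = (d : ℝ) • (((a₂ : ℚ) : ℝ), ((b₂ : ℚ) : ℝ)) := by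
    ext
    · simp only [natPoint_apply, hv, hd, Prod.smul_mk, smul_eq_mul]
      push_cast
      rw [hcast]
      push_cast
      ring
    · simp only [natPoint_apply, hv, hd, Prod.smul_mk, smul_eq_mul]
      push_cast
      rw [hcast]
      push_cast
      ring
  have hue : natPoint u = (d * c₁) • e₁ := by rw [hu', ← hce₁, smul_smul]
  have hve : natPoint v = (d * c₂) • e₂ := by rw [hv', ← hce₂, smul_smul]
  have hu1 : (u.1 : ℝ) = d * c₁ * e₁.1 := congrArg Prod.fst hue
  have hu2 : (u.2 : ℝ) = d * c₁ * e₁.2 := congrArg Prod.snd hue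
  have hv1 : (v.1 : ℝ) = d * c₂ * e₂.1 := congrArg Prod.fst hve
  have hv2 : (v.2 : ℝ) = d * c₂ * e₂.2 := congrArg Prod.snd hve
  simp only [crossForm_apply] at H₁ H₂ hD
  have hdet : (u.2 * v.1 : ℝ) < u.1 * v.2 := by
    rw [hu1, hu2, hv1, hv2]
    have : 0 < (d * c₁) * (d * c₂) * (e₁.1 * e₂.2 - e₁.2 * e₂.1) := by positivity
    linarith
  -- Each point off the line has some `K` by the Archimedean property; the maximum over the points
  -- serves all of them.
  have hgap : ∀ p ∈ F.points, ∃ K : ℕ,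
      d * (v.2 * p.1 + u.1 * p.2) + u.2 * v.1 = u.1 * v.2 + d * (v.1 * p.2 + u.2 * p.1) ∨
      (u.1 * v.2 - u.2 * v.1 : ℝ) ≤ K * |(u.1 * v.2 + d * (v.1 * p.2 + u.2 * p.1)) -
        (d * (v.2 * p.1 + u.1 * p.2) + u.2 * v.1)| := by
    intro p _
    by_cases heq : (d * (v.2 * p.1 + u.1 * p.2) + u.2 * v.1 : ℝ) =
        u.1 * v.2 + d * (v.1 * p.2 + u.2 * p.1)
    · exact ⟨0, Or.inl heq⟩
    · have habs := abs_pos.2 (sub_ne_zero.2 (Ne.symm heq))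
      obtain ⟨K, hK⟩ := Archimedean.arch (u.1 * v.2 - u.2 * v.1 : ℝ) habs
      exact ⟨K, Or.inr (by rwa [nsmul_eq_mul] at hK)⟩
  choose! k hk using hgap
  classical
  refine ⟨d, F.points.toFinset.sup k, u, v, hd0, by exact_mod_cast hdet, ?_, ?_, ?_, ?_, ?_⟩
  · rw [hu']
    exact Set.smul_mem_smul_set hm₁
  · rw [hv']
    exact Set.smul_mem_smul_set hm₂
  · intro p hp
    rw [hv1, hv2]
    have : 0 ≤ (d * c₂) * -(e₂.1 * p.2 - e₂.2 * p.1) :=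
      mul_nonneg (by positivity) (neg_nonneg.2 (H₂ p hp))
    linarith
  · intro p hp
    rw [hu1, hu2]
    have : 0 ≤ (d * c₁) * (e₁.1 * p.2 - e₁.2 * p.1) := mul_nonneg (by positivity) (H₁ p hp)
    linarith
  · intro p hp
    rcases hk p hp with h | h
    · exact Or.inl h
    · right
      have hle : (k p : ℝ) ≤ ((F.points.toFinset.sup k : ℕ) : ℝ) := by
        exact_mod_cast Finset.le_sup (f := k) (List.mem_toFinset.2 hp)
      have h' := h.trans (mul_le_mul_of_nonneg_right hle (abs_nonneg _))
      rcases abs_cases ((u.1 * v.2 + d * (v.1 * p.2 + u.2 * p.1)) -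
        (d * (v.2 * p.1 + u.1 * p.2) + u.2 * v.1) : ℝ) with ⟨h1, _⟩ | ⟨h1, _⟩
      · left
        rw [h1] at h'
        linarith
      · right
        rw [h1] at h'
        linarith

end ConvexPolygon

/-! ### Membership in a multiple by orientations -/

/-- The orientation of the triangle with vertices `x`, `j p`, `j q`, divided by `j`. -/
def scaledOrientation (j : ℕ) (x : ℕ × ℕ) (p q : ℝ × ℝ) : ℝ :=
  j * (p.1 * q.2 - p.2 * q.1) + x.2 * q.1 + x.1 * p.2 - x.2 * p.1 - x.1 * q.2

/-- Expresses a weak inequality as the failure of a strict one, the only kind of sign that may be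
asked for. -/
theorem scaledOrientation_swap (j : ℕ) (x : ℕ × ℕ) (p q : ℝ × ℝ) :
    scaledOrientation j x q p = -scaledOrientation j x p q := by
  simp only [scaledOrientation]
  ring

namespace ConvexPolygon

theorem exists_crossForm_sub_ne_zero (F : ConvexPolygon) {p q : ℝ × ℝ} (h : p ≠ q) :
    ∃ r ∈ F.points, crossForm (q - p) (r - p) ≠ 0 := by
  obtain ⟨r, hr, h⟩ := F.exists_form_ne (crossForm_ne_zero (sub_ne_zero.2 h.symm))
    (crossForm (q - p) p)
  exact ⟨r, hr, by rwa [map_sub, sub_ne_zero]⟩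

theorem crossForm_sub_ne_zero_of_affineIndependent {p q r : ℝ × ℝ}
    (h : AffineIndependent ℝ ((↑) : ({p, q, r} : Finset (ℝ × ℝ)) → ℝ × ℝ)) (hpq : p ≠ q)
    (hpr : p ≠ r) (hqr : q ≠ r) : crossForm (q - p) (r - p) ≠ 0 := by
  intro h0
  have hcol : Collinear ℝ {p, q, r} := by
    rw [collinear_iff_of_mem (p₀ := p) (by simp)]
    refine ⟨q - p, ?_⟩
    obtain ⟨c, hc⟩ := Submodule.mem_span_singleton.1
      ((mem_span_iff_crossForm (sub_ne_zero.2 hpq.symm)).2 h0)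
    intro z hz
    rcases hz with rfl | rfl | rfl
    · exact ⟨0, by simp⟩
    · exact ⟨1, by simp⟩
    · exact ⟨c, by simp [hc]⟩
  refine affineIndependent_iff_not_collinear_set.1 ?_ hcol
  have hmem : ∀ i, ![p, q, r] i ∈ ({p, q, r} : Finset (ℝ × ℝ)) := by
    intro i
    fin_cases i <;> simp
  have hinj : Function.Injective fun i => (⟨![p, q, r] i, hmem i⟩ : ({p, q, r} : Finset (ℝ × ℝ))) := by
    intro i k hik
    have hik := congrArg Subtype.val hik
    fin_cases i <;> fin_cases k <;> simp_all
  exact h.comp_embedding ⟨_, hinj⟩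

/-- A point of a polygon lies in a nondegenerate triangle of points that present the polygon. -/
theorem exists_triangle {F : ConvexPolygon} {z : ℝ × ℝ} (hz : z ∈ F.body) :
    ∃ p ∈ F.points, ∃ q ∈ F.points, ∃ r ∈ F.points, 0 < crossForm (q - p) (r - p) ∧
      ∃ a b c : ℝ, 0 ≤ a ∧ 0 ≤ b ∧ 0 ≤ c ∧ a + b + c = 1 ∧ a • p + b • q + c • r = z := by
  classical
  have key : ∀ p ∈ F.points, ∀ q ∈ F.points, ∀ r ∈ F.points, crossForm (q - p) (r - p) ≠ 0 →
      ∀ a b c : ℝ, 0 ≤ a → 0 ≤ b → 0 ≤ c → a + b + c = 1 → a • p + b • q + c • r = z →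
      ∃ p ∈ F.points, ∃ q ∈ F.points, ∃ r ∈ F.points, 0 < crossForm (q - p) (r - p) ∧
        ∃ a b c : ℝ, 0 ≤ a ∧ 0 ≤ b ∧ 0 ≤ c ∧ a + b + c = 1 ∧ a • p + b • q + c • r = z := by
    intro p hp q hq r hr h0 a b c ha hb hc habc hz
    rcases lt_or_gt_of_ne h0 with h | h
    · refine ⟨p, hp, r, hr, q, hq, ?_, a, c, b, ha, hc, hb, by linarith, ?_⟩
      · simp only [crossForm_apply] at h ⊢
        linarith
      · rw [← hz]
        abel
    · exact ⟨p, hp, q, hq, r, hr, h, a, b, c, ha, hb, hc, habc, hz⟩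
  have key2 : ∀ p ∈ F.points, ∀ q ∈ F.points, p ≠ q → ∀ a b : ℝ, 0 ≤ a → 0 ≤ b → a + b = 1 →
      a • p + b • q = z →
      ∃ p ∈ F.points, ∃ q ∈ F.points, ∃ r ∈ F.points, 0 < crossForm (q - p) (r - p) ∧
        ∃ a b c : ℝ, 0 ≤ a ∧ 0 ≤ b ∧ 0 ≤ c ∧ a + b + c = 1 ∧ a • p + b • q + c • r = z := by
    intro p hp q hq hpq a b ha hb hab hz
    obtain ⟨r, hr, h0⟩ := F.exists_crossForm_sub_ne_zero hpq
    exact key p hp q hq r hr h0 a b 0 ha hb le_rfl (by linarith) (by rw [zero_smul, add_zero, hz])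
  -- Carathéodory gives at most three affinely independent points; one or two points are completed
  -- to a triangle with further given points of weight zero.
  rw [body, convexHull_eq_union] at hz
  simp only [Set.mem_iUnion] at hz
  obtain ⟨t, hts, hind, hzt⟩ := hz
  obtain ⟨w, hw0, hw1, hwz⟩ := Finset.mem_convexHull'.1 hzt
  have hcard : t.card ≤ 3 := by
    have := hind.card_le_finrank_succ
    have hle := Submodule.finrank_le (vectorSpan ℝ (Set.range ((↑) : t → ℝ × ℝ)))
    simp at this hle
    omega
  have hne : t.card ≠ 0 := by
    intro h
    rw [Finset.card_eq_zero] at h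
    simp [h] at hw1
  have hmem : ∀ p ∈ t, p ∈ F.points := fun p hp => hts hp
  interval_cases h : t.card
  · exact absurd rfl hne
  · obtain ⟨p, rfl⟩ := Finset.card_eq_one.1 h
    simp only [Finset.sum_singleton] at hw1 hwz
    have hp := hmem p (by simp)
    obtain ⟨q, hq, hqp⟩ : ∃ q ∈ F.points, q ≠ p := by
      obtain ⟨q, hq, hne⟩ := F.exists_form_ne (f := LinearMap.fst ℝ ℝ ℝ)
        (fun h => by simpa using LinearMap.congr_fun h (1, 0)) p.1
      exact ⟨q, hq, fun h => hne (by simp [h])⟩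
    exact key2 p hp q hq hqp.symm 1 0 zero_le_one le_rfl (by ring) (by simp [← hwz, hw1])
  · obtain ⟨p, q, hpq, rfl⟩ := Finset.card_eq_two.1 h
    rw [Finset.sum_pair hpq] at hw1 hwz
    exact key2 p (hmem p (by simp)) q (hmem q (by simp)) hpq _ _ (hw0 p (by simp))
      (hw0 q (by simp)) hw1 hwz
  · obtain ⟨p, q, r, hpq, hpr, hqr, rfl⟩ := Finset.card_eq_three.1 h
    have hsum : ∀ {M : Type} [AddCommMonoid M] (f : ℝ × ℝ → M),
        ∑ x ∈ ({p, q, r} : Finset (ℝ × ℝ)), f x = f p + f q + f r := by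
      intro M _ f
      rw [Finset.sum_insert (by simp [hpq, hpr]), Finset.sum_pair hqr, add_assoc]
    rw [hsum] at hw1 hwz
    exact key p (hmem p (by simp)) q (hmem q (by simp)) r (hmem r (by simp))
      (crossForm_sub_ne_zero_of_affineIndependent hind hpq hpr hqr) _ _ _ (hw0 p (by simp))
      (hw0 q (by simp)) (hw0 r (by simp)) hw1 hwz

/-- Membership in a multiple of the polygon is decided by orientations of triangles. -/
theorem mem_smul_body_iff {F : ConvexPolygon} {j : ℕ} (hj : j ≠ 0) (x : ℕ × ℕ) :
    natPoint x ∈ (j : ℝ) • F.body ↔ ∃ p ∈ F.points, ∃ q ∈ F.points, ∃ r ∈ F.points,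
      (¬0 < scaledOrientation j x r q ∧ ¬0 < scaledOrientation j x p r ∧
        ¬0 < scaledOrientation j x q p) ∧
      (0 < scaledOrientation j x q r ∨ 0 < scaledOrientation j x r p ∨
        0 < scaledOrientation j x p q) := by
  have hj' : (0 : ℝ) < j := by positivity
  constructor
  · rintro ⟨z, hz, hzx⟩
    dsimp only at hzx
    obtain ⟨p, hp, q, hq, r, hr, hD, a, b, c, ha, hb, hc, habc, hz⟩ := exists_triangle hz
    have hx1 : (x.1 : ℝ) = j * (a * p.1 + b * q.1 + c * r.1) := by
      have := congrArg Prod.fst (hz ▸ hzx)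
      simpa [mul_add] using this.symm
    have hx2 : (x.2 : ℝ) = j * (a * p.2 + b * q.2 + c * r.2) := by
      have := congrArg Prod.snd (hz ▸ hzx)
      simpa [mul_add] using this.symm
    obtain rfl : c = 1 - a - b := by linarith
    have h1 : scaledOrientation j x q r = j * (a * crossForm (q - p) (r - p)) := by
      simp [scaledOrientation, hx1, hx2]
      ring
    have h2 : scaledOrientation j x r p = j * (b * crossForm (q - p) (r - p)) := by
      simp [scaledOrientation, hx1, hx2]
      ring
    have h3 : scaledOrientation j x p q = j * ((1 - a - b) * crossForm (q - p) (r - p)) := by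
      simp [scaledOrientation, hx1, hx2]
      ring
    refine ⟨p, hp, q, hq, r, hr, ⟨?_, ?_, ?_⟩, ?_⟩
    · rw [scaledOrientation_swap, h1, not_lt, neg_nonpos]
      positivity
    · rw [scaledOrientation_swap, h2, not_lt, neg_nonpos]
      positivity
    · rw [scaledOrientation_swap, h3, not_lt, neg_nonpos]
      positivity
    · rw [h1, h2, h3]
      rcases ha.eq_or_lt with rfl | ha
      · rcases hb.eq_or_lt with rfl | hb
        · right; right
          simp only [sub_zero, one_mul]
          positivity
        · right; left
          positivity
      · left
        positivity
  · rintro ⟨p, hp, q, hq, r, hr, ⟨h1, h2, h3⟩, hpos⟩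
    rw [scaledOrientation_swap, not_lt, neg_nonpos] at h1 h2 h3
    set A := scaledOrientation j x q r with hA
    set B := scaledOrientation j x r p with hB
    set C := scaledOrientation j x p q with hC
    -- The orientations are barycentric coordinates up to normalization. The strict inequality among
    -- the three is what excludes a degenerate triangle, for which the sum would vanish.
    have hS : 0 < A + B + C := by rcases hpos with h | h | h <;> linarith
    refine ⟨(A / (A + B + C)) • p + (B / (A + B + C)) • q + (C / (A + B + C)) • r, ?_, ?_⟩
    · have h := F.convex_body.sum_mem (t := Finset.univ)
        (w := ![A / (A + B + C), B / (A + B + C), C / (A + B + C)]) (z := ![p, q, r]) ?_ ?_ ?_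
      · simpa [Fin.sum_univ_three] using h
      · intro i _
        fin_cases i
        · exact div_nonneg h1 hS.le
        · exact div_nonneg h2 hS.le
        · exact div_nonneg h3 hS.le
      · simp [Fin.sum_univ_three]
        field_simp
      · intro i _
        fin_cases i
        · exact F.mem_body_of_mem_points hp
        · exact F.mem_body_of_mem_points hq
        · exact F.mem_body_of_mem_points hr
    · have e1 : (j : ℝ) * (A * p.1 + B * q.1 + C * r.1) = (A + B + C) * x.1 := by
        simp only [hA, hB, hC, scaledOrientation]
        ring
      have e2 : (j : ℝ) * (A * p.2 + B * q.2 + C * r.2) = (A + B + C) * x.2 := by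
        simp only [hA, hB, hC, scaledOrientation]
        ring
      clear_value A B C
      ext
      · simp
        field_simp
        linarith
      · simp
        field_simp
        linarith

end ConvexPolygon

/-! ### The algorithm -/

/-- The question for the sign of `scaledOrientation j x pₖ pₗ`. -/
def triangleQuery (j : ℕ) (x : ℕ × ℕ) (k l : ℕ) : SignQuery :=
  ((x.2, x.1, 0), (x.2, x.1, 0), j, k, l)

/-- The question for the sign of an affine function at the point `pₖ`, whose coefficients are the
differences of the given triples. -/
def affineQuery (s t : ℕ × ℕ × ℕ) (k : ℕ) : SignQuery := (s, t, 0, k, k)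

/-- The question with code `z` of the algorithm for `m` real inputs. -/
def signQuestion (s : ℕ × ℕ) : IntPoly := SignQuery.poly s.1 (Denumerable.ofNat SignQuery s.2)

/-- The answers `h` contain the answer `b` to the question `q`. -/
def Answered (b : Bool) (h : List Bool) (q : SignQuery) : Prop :=
  h.reverse[Encodable.encode q]? = some b

/-- The answers show that `x` lies in the `j`-th multiple of the polygon. -/
def InMultiple (m : ℕ) (h : List Bool) (j : ℕ) (x : ℕ × ℕ) : Prop :=
  ∃ k < m / 2, ∃ l < m / 2, ∃ r < m / 2,
    (Answered false h (triangleQuery j x r l) ∧ Answered false h (triangleQuery j x k r) ∧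
      Answered false h (triangleQuery j x l k)) ∧
    (Answered true h (triangleQuery j x l r) ∨ Answered true h (triangleQuery j x r k) ∨
      Answered true h (triangleQuery j x k l))

/-- The components `d`, `K`, `u`, `v` of a lattice frame. -/
abbrev FrameCode := ℕ × ℕ × (ℕ × ℕ) × ℕ × ℕ

/-- The answers show that the `k`-th point satisfies the conditions of a lattice frame. -/
def PointAdmissible (h : List Bool) (c : FrameCode) (k : ℕ) : Prop :=
  Answered false h (affineQuery (0, c.2.2.2.1, 0) (c.2.2.2.2, 0, 0) k) ∧
  Answered false h (affineQuery (c.2.2.1.2, 0, 0) (0, c.2.2.1.1, 0) k) ∧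
  ((Answered false h (affineQuery
      (c.1 * c.2.2.2.2, c.1 * c.2.2.1.1, c.2.2.1.2 * c.2.2.2.1)
      (c.1 * c.2.2.1.2, c.1 * c.2.2.2.1, c.2.2.1.1 * c.2.2.2.2) k) ∧
    Answered false h (affineQuery
      (c.1 * c.2.2.1.2, c.1 * c.2.2.2.1, c.2.2.1.1 * c.2.2.2.2)
      (c.1 * c.2.2.2.2, c.1 * c.2.2.1.1, c.2.2.1.2 * c.2.2.2.1) k)) ∨
   Answered false h (affineQuery
      (c.2.1 * (c.1 * c.2.2.2.2), c.2.1 * (c.1 * c.2.2.1.1),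
        c.2.2.1.1 * c.2.2.2.2 + c.2.1 * (c.2.2.1.2 * c.2.2.2.1))
      (c.2.1 * (c.1 * c.2.2.1.2), c.2.1 * (c.1 * c.2.2.2.1),
        c.2.2.1.2 * c.2.2.2.1 + c.2.1 * (c.2.2.1.1 * c.2.2.2.2)) k) ∨
   Answered false h (affineQuery
      (c.2.1 * (c.1 * c.2.2.1.2), c.2.1 * (c.1 * c.2.2.2.1),
        c.2.2.1.1 * c.2.2.2.2 + c.2.1 * (c.2.2.1.1 * c.2.2.2.2))
      (c.2.1 * (c.1 * c.2.2.2.2), c.2.1 * (c.1 * c.2.2.1.1),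
        c.2.2.1.2 * c.2.2.2.1 + c.2.1 * (c.2.2.1.2 * c.2.2.2.1)) k))

/-- The box in which a frame locates generators. -/
def FrameCode.box (c : FrameCode) : ℕ := ConvexPolygon.boxBound c.2.1 c.2.2.1 c.2.2.2

/-- The indices that a frame allows for elements of the box. -/
def FrameCode.index (c : FrameCode) : ℕ := ConvexPolygon.indexBound c.1 c.2.1 c.2.2.1 c.2.2.2

/-- The answers show that `c` is a lattice frame, and they decide membership in the box. -/
def FrameVerified (s : ℕ × List Bool) (c : FrameCode) : Prop :=
  -- By monotonicity of the encoding, this single bound ensures that all membership questions for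
  -- the box and the allowed indices have been answered, so a missing positive verdict means
  -- nonmembership.
  Encodable.encode (triangleQuery c.index (c.box, c.box) s.1 s.1) < s.2.length ∧
  0 < c.1 ∧ c.2.2.1.2 * c.2.2.2.1 < c.2.2.1.1 * c.2.2.2.2 ∧
  InMultiple s.1 s.2 c.1 c.2.2.1 ∧ InMultiple s.1 s.2 c.1 c.2.2.2 ∧
  ∀ k < s.1 / 2, PointAdmissible s.2 c k

open Classical in
/-- The nonzero elements of the semigroup in the box. -/
noncomputable def boxElements (s : ℕ × List Bool) (c : FrameCode) : List (ℕ × ℕ) :=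
  ((List.range (Nat.pair c.box c.box + 1)).map Nat.unpair).filter fun x =>
    (x ≠ (0, 0) ∧ x.1 ≤ c.box ∧ x.2 ≤ c.box) ∧
      -- The triangle criterion presupposes a nonzero index; index `0` would contribute only the
      -- origin.
      ∃ j < c.index + 1, j ≠ 0 ∧ InMultiple s.1 s.2 j x

open Classical in
/-- The elements of a list that are not sums of two elements of the list. -/
noncomputable def indecomposables (M : List (ℕ × ℕ)) : List (ℕ × ℕ) :=
  M.filter fun x => ∀ y ∈ M, ∀ z ∈ M, (y.1 + z.1, y.2 + z.2) ≠ x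

/-! ### Primitive recursiveness of the test and of the output -/

section Primrec

variable {α : Type*} [Primcodable α]

theorem PrimrecRel.exists_lt_right {p : α → ℕ → Prop} (hp : PrimrecRel p) {f : α → ℕ}
    (hf : Primrec f) : PrimrecPred fun a => ∃ k < f a, p a k :=
  ((PrimrecRel.exists_mem_list (R := fun k a => p a k) hp.swap).comp
    (Primrec.list_range.comp hf) Primrec.id).of_eq fun a => by simp

theorem PrimrecRel.forall_lt_right {p : α → ℕ → Prop} (hp : PrimrecRel p) {f : α → ℕ}
    (hf : Primrec f) : PrimrecPred fun a => ∀ k < f a, p a k :=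
  ((PrimrecRel.forall_mem_list (R := fun k a => p a k) hp.swap).comp
    (Primrec.list_range.comp hf) Primrec.id).of_eq fun a => by simp

theorem primrec_triangleQuery {j : α → ℕ} {x : α → ℕ × ℕ} {k l : α → ℕ} (hj : Primrec j)
    (hx : Primrec x) (hk : Primrec k) (hl : Primrec l) :
    Primrec fun a => triangleQuery (j a) (x a) (k a) (l a) := by
  have h : Primrec fun a => ((x a).2, (x a).1, 0) :=
    (Primrec.snd.comp hx).pair ((Primrec.fst.comp hx).pair (Primrec.const 0))
  exact h.pair (h.pair (hj.pair (hk.pair hl)))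

theorem primrec_affineQuery {a b c a' b' c' k : α → ℕ} (ha : Primrec a) (hb : Primrec b)
    (hc : Primrec c) (ha' : Primrec a') (hb' : Primrec b') (hc' : Primrec c') (hk : Primrec k) :
    Primrec fun t => affineQuery (a t, b t, c t) (a' t, b' t, c' t) (k t) :=
  (ha.pair (hb.pair hc)).pair ((ha'.pair (hb'.pair hc')).pair ((Primrec.const 0).pair (hk.pair hk)))

theorem primrec_signQuestion : Primrec signQuestion :=
  SignQuery.primrec_poly.comp Primrec.fst ((Primrec.ofNat SignQuery).comp Primrec.snd)

theorem primrec_answered {h : α → List Bool} {q : α → SignQuery} (b : Bool) (hh : Primrec h)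
    (hq : Primrec q) : PrimrecPred fun a => Answered b (h a) (q a) :=
  Primrec.eq.comp (Primrec.list_getElem?.comp (Primrec.list_reverse.comp hh)
    (Primrec.encode.comp hq)) (Primrec.const (some b))

theorem primrec_inMultiple {m : α → ℕ} {h : α → List Bool} {j : α → ℕ} {x : α → ℕ × ℕ}
    (hm : Primrec m) (hh : Primrec h) (hj : Primrec j) (hx : Primrec x) :
    PrimrecPred fun a => InMultiple (m a) (h a) (j a) (x a) := by
  have half : Primrec fun a => m a / 2 := Primrec.nat_div.comp hm (Primrec.const 2)
  have fst3 : Primrec fun t : ((α × ℕ) × ℕ) × ℕ => t.1.1.1 := .comp .fst (.comp .fst .fst)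
  have hk : Primrec fun t : ((α × ℕ) × ℕ) × ℕ => t.1.1.2 := .comp .snd (.comp .fst .fst)
  have hl : Primrec fun t : ((α × ℕ) × ℕ) × ℕ => t.1.2 := .comp .snd .fst
  have hr : Primrec fun t : ((α × ℕ) × ℕ) × ℕ => t.2 := .snd
  have ans : ∀ (b : Bool) {k l : ((α × ℕ) × ℕ) × ℕ → ℕ}, Primrec k → Primrec l →
      PrimrecPred fun t => Answered b (h t.1.1.1) (triangleQuery (j t.1.1.1) (x t.1.1.1) (k t) (l t)) :=
    fun b _ _ hk hl => primrec_answered b (hh.comp fst3)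
      (primrec_triangleQuery (hj.comp fst3) (hx.comp fst3) hk hl)
  have body := ((ans false hr hl).and ((ans false hk hr).and (ans false hl hk))).and
    ((ans true hl hr).or ((ans true hr hk).or (ans true hk hl)))
  exact PrimrecRel.exists_lt_right (PrimrecRel.exists_lt_right (PrimrecRel.exists_lt_right
    body.primrecRel (half.comp (.comp .fst .fst))).primrecRel (half.comp .fst)).primrecRel half

theorem primrec_pointAdmissible {h : α → List Bool} {c : α → FrameCode} {k : α → ℕ}
    (hh : Primrec h) (hc : Primrec c) (hk : Primrec k) :
    PrimrecPred fun a => PointAdmissible (h a) (c a) (k a) := by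
  have z : Primrec fun _ : α => 0 := .const 0
  have d : Primrec fun a => (c a).1 := .comp .fst hc
  have K : Primrec fun a => (c a).2.1 := .comp .fst (.comp .snd hc)
  have u : Primrec fun a => (c a).2.2.1 := .comp .fst (.comp .snd (.comp .snd hc))
  have v : Primrec fun a => (c a).2.2.2 := .comp .snd (.comp .snd (.comp .snd hc))
  have u1 := Primrec.fst.comp u
  have u2 := Primrec.snd.comp u
  have v1 := Primrec.fst.comp v
  have v2 := Primrec.snd.comp v
  have mul : ∀ {f g : α → ℕ}, Primrec f → Primrec g → Primrec fun a => f a * g a :=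
    fun hf hg => Primrec.nat_mul.comp hf hg
  have add : ∀ {f g : α → ℕ}, Primrec f → Primrec g → Primrec fun a => f a + g a :=
    fun hf hg => Primrec.nat_add.comp hf hg
  refine (primrec_answered false hh (primrec_affineQuery z v1 z v2 z z hk)).and
    ((primrec_answered false hh (primrec_affineQuery u2 z z z u1 z hk)).and
    (((primrec_answered false hh (primrec_affineQuery (mul d v2) (mul d u1) (mul u2 v1)
      (mul d u2) (mul d v1) (mul u1 v2) hk)).and
    (primrec_answered false hh (primrec_affineQuery (mul d u2) (mul d v1) (mul u1 v2)
      (mul d v2) (mul d u1) (mul u2 v1) hk))).or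
    ((primrec_answered false hh (primrec_affineQuery (mul K (mul d v2)) (mul K (mul d u1))
      (add (mul u1 v2) (mul K (mul u2 v1))) (mul K (mul d u2)) (mul K (mul d v1))
      (add (mul u2 v1) (mul K (mul u1 v2))) hk)).or
    (primrec_answered false hh (primrec_affineQuery (mul K (mul d u2)) (mul K (mul d v1))
      (add (mul u1 v2) (mul K (mul u1 v2))) (mul K (mul d v2)) (mul K (mul d u1))
      (add (mul u2 v1) (mul K (mul u2 v1))) hk)))))

theorem primrec_box {c : α → FrameCode} (hc : Primrec c) : Primrec fun a => (c a).box := by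
  have K : Primrec fun a => (c a).2.1 := .comp .fst (.comp .snd hc)
  have u : Primrec fun a => (c a).2.2.1 := .comp .fst (.comp .snd (.comp .snd hc))
  have v : Primrec fun a => (c a).2.2.2 := .comp .snd (.comp .snd (.comp .snd hc))
  exact Primrec.nat_mul.comp (Primrec.nat_add.comp K (.const 2))
    (Primrec.nat_add.comp (Primrec.nat_add.comp (Primrec.nat_add.comp (Primrec.fst.comp u)
      (Primrec.snd.comp u)) (Primrec.fst.comp v)) (Primrec.snd.comp v))

theorem primrec_index {c : α → FrameCode} (hc : Primrec c) : Primrec fun a => (c a).index := by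
  have u : Primrec fun a => (c a).2.2.1 := .comp .fst (.comp .snd (.comp .snd hc))
  have v : Primrec fun a => (c a).2.2.2 := .comp .snd (.comp .snd (.comp .snd hc))
  exact Primrec.nat_mul.comp (Primrec.nat_mul.comp (Primrec.fst.comp hc) (primrec_box hc))
    (Primrec.nat_add.comp (Primrec.fst.comp u) (Primrec.snd.comp v))

theorem primrec_frameVerified {s : α → ℕ × List Bool} {c : α → FrameCode} (hs : Primrec s)
    (hc : Primrec c) : PrimrecPred fun a => FrameVerified (s a) (c a) := by
  have m := Primrec.fst.comp hs
  have h := Primrec.snd.comp hs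
  have d : Primrec fun a => (c a).1 := .comp .fst hc
  have u : Primrec fun a => (c a).2.2.1 := .comp .fst (.comp .snd (.comp .snd hc))
  have v : Primrec fun a => (c a).2.2.2 := .comp .snd (.comp .snd (.comp .snd hc))
  refine (Primrec.nat_lt.comp (Primrec.encode.comp (primrec_triangleQuery (primrec_index hc)
    ((primrec_box hc).pair (primrec_box hc)) m m)) (Primrec.list_length.comp h)).and
    ((Primrec.nat_lt.comp (.const 0) d).and ((Primrec.nat_lt.comp
      (Primrec.nat_mul.comp (Primrec.snd.comp u) (Primrec.fst.comp v))
      (Primrec.nat_mul.comp (Primrec.fst.comp u) (Primrec.snd.comp v))).and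
    ((primrec_inMultiple m h d u).and ((primrec_inMultiple m h d v).and ?_))))
  exact PrimrecRel.forall_lt_right (primrec_pointAdmissible (h.comp .fst) (hc.comp .fst)
    .snd).primrecRel (Primrec.nat_div.comp m (.const 2))

theorem primrec_boxElements {s : α → ℕ × List Bool} {c : α → FrameCode} (hs : Primrec s)
    (hc : Primrec c) : Primrec fun a => boxElements (s a) (c a) := by
  classical
  have b := primrec_box hc
  have hb : Primrec fun t : (ℕ × ℕ) × α => (c t.2).box := b.comp .snd
  have hx1 : Primrec fun t : (ℕ × ℕ) × α => t.1.1 := .comp .fst .fst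
  have hx2 : Primrec fun t : (ℕ × ℕ) × α => t.1.2 := .comp .snd .fst
  have hlist : Primrec fun a => (List.range (Nat.pair (c a).box (c a).box + 1)).map Nat.unpair :=
    Primrec.list_map (Primrec.list_range.comp (Primrec.succ.comp (Primrec₂.natPair.comp b b)))
      (Primrec.unpair.comp .snd).to₂
  have hinner : PrimrecPred fun t : (ℕ × ℕ) × α => ∃ j < (c t.2).index + 1, j ≠ 0 ∧
      InMultiple (s t.2).1 (s t.2).2 j t.1 :=
    PrimrecRel.exists_lt_right (p := fun (t : (ℕ × ℕ) × α) j => j ≠ 0 ∧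
        InMultiple (s t.2).1 (s t.2).2 j t.1)
      ((Primrec.eq.comp .snd (.const 0)).not.and (primrec_inMultiple
        (.comp .fst (hs.comp (.comp .snd .fst))) (.comp .snd (hs.comp (.comp .snd .fst)))
        .snd (.comp .fst .fst))).primrecRel
      (Primrec.succ.comp ((primrec_index hc).comp .snd))
  have hrel : PrimrecRel fun (x : ℕ × ℕ) (a : α) =>
      (x ≠ (0, 0) ∧ x.1 ≤ (c a).box ∧ x.2 ≤ (c a).box) ∧
      ∃ j < (c a).index + 1, j ≠ 0 ∧ InMultiple (s a).1 (s a).2 j x :=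
    (((Primrec.eq.comp .fst (.const (0, 0))).not.and
      ((Primrec.nat_le.comp hx1 hb).and (Primrec.nat_le.comp hx2 hb))).and hinner).primrecRel
  exact (hrel.listFilter.comp hlist Primrec.id).of_eq fun a => by simp [boxElements]

theorem primrec_indecomposables : Primrec indecomposables := by
  classical
  have h0 : PrimrecRel fun (z : ℕ × ℕ) (t : (ℕ × ℕ) × (ℕ × ℕ)) =>
      (t.1.1 + z.1, t.1.2 + z.2) ≠ t.2 := by
    have hsum : Primrec fun t : (ℕ × ℕ) × (ℕ × ℕ) × (ℕ × ℕ) =>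
        (t.2.1.1 + t.1.1, t.2.1.2 + t.1.2) :=
      (Primrec.nat_add.comp (.comp .fst (.comp .fst .snd)) (.comp .fst .fst)).pair
        (Primrec.nat_add.comp (.comp .snd (.comp .fst .snd)) (.comp .snd .fst))
    exact (PrimrecPred.not (Primrec.eq.comp hsum (.comp .snd .snd))).primrecRel
  have h1 : PrimrecRel fun (y : ℕ × ℕ) (t : List (ℕ × ℕ) × (ℕ × ℕ)) =>
      ∀ z ∈ t.1, (y.1 + z.1, y.2 + z.2) ≠ t.2 :=
    h0.forall_mem_list.comp (.comp .fst .snd) (Primrec.fst.pair (.comp .snd .snd))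
  have h2 : PrimrecRel fun (x : ℕ × ℕ) (M : List (ℕ × ℕ)) =>
      ∀ y ∈ M, ∀ z ∈ M, (y.1 + z.1, y.2 + z.2) ≠ x :=
    h1.forall_mem_list.comp .snd (Primrec.snd.pair .fst)
  exact (h2.listFilter.comp Primrec.id Primrec.id).of_eq fun M => by simp [indecomposables]

end Primrec

/-! ### Correctness of the algorithm -/

theorem Nat.pair_le_pair {a b c d : ℕ} (h1 : a ≤ b) (h2 : c ≤ d) : Nat.pair a c ≤ Nat.pair b d := by
  rcases h1.eq_or_lt with rfl | h1
  · rcases h2.eq_or_lt with rfl | h2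
    · exact le_rfl
    · exact (Nat.pair_lt_pair_right _ h2).le
  · refine (Nat.pair_lt_pair_left c h1).le.trans ?_
    rcases h2.eq_or_lt with rfl | h2
    · exact le_rfl
    · exact (Nat.pair_lt_pair_right _ h2).le

/-- Codes are nested values of `Nat.pair`, which is monotone in both arguments; this justifies the
length test in `FrameVerified`. -/
theorem encode_triangleQuery_le {j J : ℕ} {x y : ℕ × ℕ} {k l m : ℕ} (hj : j ≤ J)
    (h1 : x.1 ≤ y.1) (h2 : x.2 ≤ y.2) (hk : k ≤ m) (hl : l ≤ m) :
    Encodable.encode (triangleQuery j x k l) ≤ Encodable.encode (triangleQuery J y m m) := by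
  have h : Nat.pair x.2 (Nat.pair x.1 0) ≤ Nat.pair y.2 (Nat.pair y.1 0) :=
    Nat.pair_le_pair h2 (Nat.pair_le_pair h1 le_rfl)
  exact Nat.pair_le_pair h (Nat.pair_le_pair h (Nat.pair_le_pair hj (Nat.pair_le_pair hk hl)))

/-- A downward closed system of generators of a semigroup in `ℕ²` contains a minimal one, which
consists of its indecomposable elements. -/
theorem isMinimalGeneratingSystem_indecomposables {S : AddSubmonoid (ℕ × ℕ)} {M : List (ℕ × ℕ)}
    (hMS : ∀ x ∈ M, x ∈ S ∧ x ≠ 0) (hgen : ∀ x ∈ S, x ∈ AddSubmonoid.closure {y | y ∈ M})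
    (hdown : ∀ y ∈ S, ∀ z ∈ S, y ≠ 0 → z ≠ 0 → y + z ∈ M → y ∈ M ∧ z ∈ M) :
    IsMinimalGeneratingSystem S {g | g ∈ indecomposables M} := by
  classical
  have hmem : ∀ x, x ∈ indecomposables M ↔ x ∈ M ∧ ∀ y ∈ M, ∀ z ∈ M, y + z ≠ x := by
    intro x
    rw [indecomposables, List.mem_filter, decide_eq_true_iff]
    rfl
  have hpos : ∀ x ∈ M, 0 < x.1 + x.2 := by
    intro x hx
    by_contra! h
    exact (hMS x hx).2 (Prod.ext (by simp; omega) (by simp; omega))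
  have hM : ∀ n, ∀ x ∈ M, x.1 + x.2 = n →
      x ∈ AddSubmonoid.closure {g | g ∈ indecomposables M} := by
    intro n
    induction n using Nat.strong_induction_on with
    | _ n ih =>
      rintro x hx rfl
      by_cases hi : x ∈ indecomposables M
      · exact AddSubmonoid.subset_closure hi
      · rw [hmem] at hi
        push Not at hi
        obtain ⟨y, hy, z, hz, rfl⟩ := hi hx
        have h1 := hpos y hy
        have h2 := hpos z hz
        exact add_mem (ih _ (by simp only [Prod.fst_add, Prod.snd_add]; omega) y hy rfl)
          (ih _ (by simp only [Prod.fst_add, Prod.snd_add]; omega) z hz rfl)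
  refine ⟨le_antisymm (AddSubmonoid.closure_le.2 fun x hx => (hMS x ((hmem x).1 hx).1).1)
    fun x hx => AddSubmonoid.closure_le.2 (fun y hy => hM _ y hy rfl) (hgen x hx),
    fun B hB hBS => ?_⟩
  obtain ⟨g, hg, hgB⟩ := Set.exists_of_ssubset hB
  -- An element generated by `B` is zero, in `B`, or a proper sum; an indecomposable element missing
  -- from `B` is none of these.
  have hdec : ∀ x ∈ AddSubmonoid.closure B,
      x = 0 ∨ x ∈ B ∨ ∃ y ∈ S, ∃ z ∈ S, y ≠ 0 ∧ z ≠ 0 ∧ y + z = x := by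
    intro x hx
    refine AddSubmonoid.closure_induction (motive := fun x _ => x = 0 ∨ x ∈ B ∨
      ∃ y ∈ S, ∃ z ∈ S, y ≠ 0 ∧ z ≠ 0 ∧ y + z = x) (fun x hx => Or.inr (Or.inl hx))
      (Or.inl rfl) ?_ hx
    intro x y hx hy ihx ihy
    by_cases hx0 : x = 0
    · simpa [hx0] using ihy
    by_cases hy0 : y = 0
    · simpa [hy0] using ihx
    exact Or.inr (Or.inr ⟨x, hBS ▸ hx, y, hBS ▸ hy, hx0, hy0, rfl⟩)
  obtain ⟨hgM, hgi⟩ := (hmem g).1 hg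
  rcases hdec g (hBS ▸ (hMS g hgM).1) with h | h | ⟨y, hy, z, hz, hy0, hz0, h⟩
  · exact (hMS g hgM).2 h
  · exact hgB h
  · obtain ⟨hyM, hzM⟩ := hdown y hy z hz hy0 hz0 (h ▸ hgM)
    exact hgi y hyM z hzM h

namespace ConvexPolygon

variable {F : ConvexPolygon}

theorem length_coordinates (F : ConvexPolygon) :
    F.coordinates.length = 2 * F.points.length := by
  rw [coordinates, List.length_flatMap]
  simp [mul_comm]

theorem coordinates_getD (F : ConvexPolygon) {k : ℕ} (hk : k < F.points.length) :
    F.coordinates.getD (2 * k) 1 = (F.points.getD k 0).1 ∧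
      F.coordinates.getD (2 * k + 1) 1 = (F.points.getD k 0).2 := by
  rw [coordinates]
  generalize F.points = l at hk
  induction l generalizing k with
  | nil => simp at hk
  | cons p l ih =>
    cases k with
    | zero => simp
    | succ k =>
      have := ih (k := k) (by simpa using hk)
      simpa [mul_add] using this

theorem half_length_coordinates (F : ConvexPolygon) :
    F.coordinates.length / 2 = F.points.length := by
  rw [length_coordinates, Nat.mul_div_cancel_left _ two_pos]

theorem getD_mem_points {k : ℕ} (hk : k < F.points.length) : F.points.getD k 0 ∈ F.points := by
  rw [List.getD_eq_getElem _ _ hk]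
  exact List.getElem_mem hk

theorem exists_getD_eq {p : ℝ × ℝ} (hp : p ∈ F.points) :
    ∃ k < F.points.length, F.points.getD k 0 = p := by
  obtain ⟨k, hk, rfl⟩ := List.mem_iff_getElem.1 hp
  exact ⟨k, hk, List.getD_eq_getElem _ _ hk⟩

/-- The answers to the first `n` questions on the coordinates of `F`. -/
noncomputable def answers (F : ConvexPolygon) (n : ℕ) : List Bool :=
  signAnswers signQuestion F.coordinates n

/-- The value at the coordinates of `F` of the polynomial with the given code. -/
noncomputable def queryValue (F : ConvexPolygon) (q : SignQuery) : ℝ :=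
  (SignQuery.poly F.coordinates.length q).value F.coordinates

/-- The question with code `z` is the one asked at step `z`, so it has been answered exactly when `z
< n`. -/
theorem answered_iff {b : Bool} {n : ℕ} {q : SignQuery} :
    Answered b (F.answers n) q ↔
      Encodable.encode q < n ∧ (0 < F.queryValue q ↔ b = true) := by
  rw [Answered, answers, signAnswers_reverse_getElem?, signQuestion, Denumerable.ofNat_encode]
  split_ifs with h
  · rw [queryValue]
    cases b <;> simp [h]
  · simp [h]

theorem queryValue_triangleQuery (F : ConvexPolygon) (j : ℕ) (x : ℕ × ℕ) {k l : ℕ}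
    (hk : k < F.points.length) (hl : l < F.points.length) :
    F.queryValue (triangleQuery j x k l) =
      scaledOrientation j x (F.points.getD k 0) (F.points.getD l 0) := by
  rw [queryValue, triangleQuery, SignQuery.value_poly, (F.coordinates_getD hk).1,
    (F.coordinates_getD hk).2, (F.coordinates_getD hl).1, (F.coordinates_getD hl).2,
    scaledOrientation]
  push_cast
  ring

theorem queryValue_affineQuery (F : ConvexPolygon) (a b c a' b' c' : ℕ) {k : ℕ}
    (hk : k < F.points.length) :
    F.queryValue (affineQuery (a, b, c) (a', b', c') k) =
      (a * (F.points.getD k 0).1 + b * (F.points.getD k 0).2 + c) -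
        (a' * (F.points.getD k 0).1 + b' * (F.points.getD k 0).2 + c') := by
  rw [queryValue, affineQuery, SignQuery.value_poly, (F.coordinates_getD hk).1,
    (F.coordinates_getD hk).2]
  push_cast
  ring

theorem mem_smul_body_of_inMultiple {n j : ℕ} (hj : j ≠ 0) {x : ℕ × ℕ}
    (h : InMultiple F.coordinates.length (F.answers n) j x) : natPoint x ∈ (j : ℝ) • F.body := by
  obtain ⟨k, hk, l, hl, r, hr, h⟩ := h
  rw [half_length_coordinates] at hk hl hr
  rw [mem_smul_body_iff hj]
  refine ⟨_, getD_mem_points hk, _, getD_mem_points hl, _, getD_mem_points hr, ?_⟩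
  simp only [answered_iff, queryValue_triangleQuery F j x hk hl,
    queryValue_triangleQuery F j x hl hk, queryValue_triangleQuery F j x hk hr,
    queryValue_triangleQuery F j x hr hk, queryValue_triangleQuery F j x hl hr,
    queryValue_triangleQuery F j x hr hl, Bool.false_eq_true, iff_false, iff_true] at h
  tauto

theorem inMultiple_of_mem_smul_body {n j : ℕ} (hj : j ≠ 0) {x : ℕ × ℕ}
    (hx : natPoint x ∈ (j : ℝ) • F.body)
    (hn : Encodable.encode (triangleQuery j x F.coordinates.length F.coordinates.length) < n) :
    InMultiple F.coordinates.length (F.answers n) j x := by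
  rw [mem_smul_body_iff hj] at hx
  obtain ⟨p, hp, q, hq, r, hr, h⟩ := hx
  obtain ⟨k, hk, rfl⟩ := exists_getD_eq hp
  obtain ⟨l, hl, rfl⟩ := exists_getD_eq hq
  obtain ⟨i, hi, rfl⟩ := exists_getD_eq hr
  have hcode : ∀ {k l}, k < F.points.length → l < F.points.length →
      Encodable.encode (triangleQuery j x k l) < n := by
    intro k l hk hl
    have := F.length_coordinates
    exact (encode_triangleQuery_le le_rfl le_rfl le_rfl (by omega) (by omega)).trans_lt hn
  have hlen := F.half_length_coordinates
  refine ⟨k, by rwa [hlen], l, by rwa [hlen], i, by rwa [hlen], ?_⟩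
  simp only [answered_iff, queryValue_triangleQuery F j x hk hl,
    queryValue_triangleQuery F j x hl hk, queryValue_triangleQuery F j x hk hi,
    queryValue_triangleQuery F j x hi hk, queryValue_triangleQuery F j x hl hi,
    queryValue_triangleQuery F j x hi hl, Bool.false_eq_true, iff_false, iff_true,
    hcode hk hl, hcode hl hk, hcode hk hi, hcode hi hk, hcode hl hi, hcode hi hl, true_and]
  exact h

/-- The conditions of a lattice frame on a single point. -/
def FrameCondition (c : FrameCode) (p : ℝ × ℝ) : Prop :=
  c.2.2.2.1 * p.2 ≤ c.2.2.2.2 * p.1 ∧ c.2.2.1.2 * p.1 ≤ c.2.2.1.1 * p.2 ∧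
  (c.1 * (c.2.2.2.2 * p.1 + c.2.2.1.1 * p.2) + c.2.2.1.2 * c.2.2.2.1 =
      c.2.2.1.1 * c.2.2.2.2 + c.1 * (c.2.2.2.1 * p.2 + c.2.2.1.2 * p.1) ∨
    c.2.2.1.1 * c.2.2.2.2 +
        c.2.1 * (c.1 * (c.2.2.2.2 * p.1 + c.2.2.1.1 * p.2) + c.2.2.1.2 * c.2.2.2.1) ≤
      c.2.2.1.2 * c.2.2.2.1 +
        c.2.1 * (c.2.2.1.1 * c.2.2.2.2 + c.1 * (c.2.2.2.1 * p.2 + c.2.2.1.2 * p.1)) ∨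
    c.2.2.1.1 * c.2.2.2.2 +
        c.2.1 * (c.2.2.1.1 * c.2.2.2.2 + c.1 * (c.2.2.2.1 * p.2 + c.2.2.1.2 * p.1)) ≤
      c.2.2.1.2 * c.2.2.2.1 +
        c.2.1 * (c.1 * (c.2.2.2.2 * p.1 + c.2.2.1.1 * p.2) + c.2.2.1.2 * c.2.2.2.1))

theorem answered_affineQuery_iff {n a b c a' b' c' k : ℕ} (hk : k < F.points.length) :
    Answered false (F.answers n) (affineQuery (a, b, c) (a', b', c') k) ↔
      Encodable.encode (affineQuery (a, b, c) (a', b', c') k) < n ∧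
      a * (F.points.getD k 0).1 + b * (F.points.getD k 0).2 + c ≤
        a' * (F.points.getD k 0).1 + b' * (F.points.getD k 0).2 + (c' : ℝ) := by
  rw [answered_iff, queryValue_affineQuery F _ _ _ _ _ _ hk]
  simp

theorem frameCondition_of_pointAdmissible {n k : ℕ} {c : FrameCode} (hk : k < F.points.length)
    (h : PointAdmissible (F.answers n) c k) : FrameCondition c (F.points.getD k 0) := by
  obtain ⟨d, K, ⟨u1, u2⟩, v1, v2⟩ := c
  simp only [PointAdmissible, answered_affineQuery_iff hk] at h
  push_cast at h
  obtain ⟨⟨_, h1⟩, ⟨_, h2⟩, h3⟩ := h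
  refine ⟨by dsimp only; linarith, by dsimp only; linarith, ?_⟩
  dsimp only
  rcases h3 with ⟨⟨_, h3⟩, _, h4⟩ | ⟨_, h3⟩ | ⟨_, h3⟩
  · left
    linarith
  · right; left
    linarith
  · right; right
    linarith

/-- The condition involves finitely many questions, and each is asked at some step. -/
theorem eventually_pointAdmissible {k : ℕ} {c : FrameCode} (hk : k < F.points.length)
    (h : FrameCondition c (F.points.getD k 0)) :
    ∀ᶠ n in Filter.atTop, PointAdmissible (F.answers n) c k := by
  obtain ⟨d, K, ⟨u1, u2⟩, v1, v2⟩ := c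
  simp only [PointAdmissible, answered_affineQuery_iff hk]
  push_cast
  obtain ⟨h1, h2, h3⟩ := h
  dsimp only at h1 h2 h3
  have ev : ∀ (q : SignQuery) {p : Prop}, p →
      ∀ᶠ n in Filter.atTop, Encodable.encode q < n ∧ p := fun q _ hp =>
    (Filter.eventually_gt_atTop _).mono fun n hn => ⟨hn, hp⟩
  refine (ev _ (by linarith)).and ((ev _ (by linarith)).and ?_)
  rcases h3 with h3 | h3 | h3
  · exact ((ev _ (by linarith)).and (ev _ (by linarith))).mono fun n hn => Or.inl hn
  · exact (ev _ (by linarith)).mono fun n hn => Or.inr (Or.inl hn)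
  · exact (ev _ (by linarith)).mono fun n hn => Or.inr (Or.inr hn)

/-- Soundness of the search: whatever candidate the answers accept is a genuine frame. -/
theorem isLatticeFrame_of_frameVerified {n : ℕ} {c : FrameCode}
    (h : FrameVerified (F.coordinates.length, F.answers n) c) :
    F.IsLatticeFrame c.1 c.2.1 c.2.2.1 c.2.2.2 := by
  obtain ⟨_, hd, hdet, hu, hv, hp⟩ := h
  have hp' : ∀ p ∈ F.points, FrameCondition c p := by
    intro p hmem
    obtain ⟨k, hk, rfl⟩ := exists_getD_eq hmem
    exact frameCondition_of_pointAdmissible hk (hp k (by rwa [half_length_coordinates]))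
  exact ⟨hd, hdet, mem_smul_body_of_inMultiple hd.ne' hu, mem_smul_body_of_inMultiple hd.ne' hv,
    fun p hp => (hp' p hp).1, fun p hp => (hp' p hp).2.1, fun p hp => (hp' p hp).2.2⟩

theorem length_answers (F : ConvexPolygon) (n : ℕ) : (F.answers n).length = n :=
  length_signAnswers _ _ _

/-- Completeness of the search: a genuine frame is accepted by every sufficiently long list of
answers. -/
theorem IsLatticeFrame.eventually_frameVerified {d K : ℕ} {u v : ℕ × ℕ}
    (h : F.IsLatticeFrame d K u v) :
    ∀ᶠ n in Filter.atTop, FrameVerified (F.coordinates.length, F.answers n) (d, K, u, v) := by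
  have hpts : ∀ᶠ n in Filter.atTop,
      ∀ k ∈ Finset.range F.points.length, PointAdmissible (F.answers n) (d, K, u, v) k := by
    rw [Filter.eventually_all_finset]
    intro k hk
    have hk := Finset.mem_range.1 hk
    have hp := getD_mem_points hk
    exact eventually_pointAdmissible hk ⟨h.left_nonneg _ hp, h.right_nonneg _ hp, h.gap _ hp⟩
  filter_upwards [hpts, Filter.eventually_gt_atTop (Encodable.encode (triangleQuery
      (FrameCode.index (d, K, u, v)) (FrameCode.box (d, K, u, v), FrameCode.box (d, K, u, v))
      F.coordinates.length F.coordinates.length)),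
    Filter.eventually_gt_atTop (Encodable.encode (triangleQuery d u F.coordinates.length
      F.coordinates.length)),
    Filter.eventually_gt_atTop (Encodable.encode (triangleQuery d v F.coordinates.length
      F.coordinates.length))] with n hn h1 h2 h3
  refine ⟨?_, h.pos, h.det_pos, inMultiple_of_mem_smul_body h.pos.ne' h.left_mem h2,
    inMultiple_of_mem_smul_body h.pos.ne' h.right_mem h3, fun k hk => hn k ?_⟩
  · rw [length_answers]
    exact h1
  · rw [Finset.mem_range, ← half_length_coordinates]
    exact hk

/-- The index bound of the frame turns the unbounded union over multiples into a finite search,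
whose questions have all been answered. -/
theorem mem_boxElements_iff {n : ℕ} {c : FrameCode}
    (h : FrameVerified (F.coordinates.length, F.answers n) c) (x : ℕ × ℕ) :
    x ∈ boxElements (F.coordinates.length, F.answers n) c ↔
      (x ≠ 0 ∧ x.1 ≤ c.box ∧ x.2 ≤ c.box) ∧ x ∈ F.semigroup := by
  classical
  rw [boxElements, List.mem_filter, decide_eq_true_iff]
  constructor
  · rintro ⟨_, hx, j, _, hj, hmem⟩
    exact ⟨hx, F.mem_semigroup.2 ⟨j, mem_smul_body_of_inMultiple hj hmem⟩⟩
  · rintro ⟨⟨hx0, hx1, hx2⟩, hx⟩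
    obtain ⟨j, hj, hmem⟩ := (isLatticeFrame_of_frameVerified h).exists_index_le hx hx1 hx2
    have hj0 : j ≠ 0 := by
      rintro rfl
      rw [Nat.cast_zero, Set.zero_smul_set F.nonempty_body] at hmem
      have h1 : (x.1 : ℝ) = 0 := congrArg Prod.fst hmem
      have h2 : (x.2 : ℝ) = 0 := congrArg Prod.snd hmem
      exact hx0 (Prod.ext (by exact_mod_cast h1) (by exact_mod_cast h2))
    refine ⟨List.mem_map.2 ⟨Nat.pair x.1 x.2, List.mem_range.2
      (Nat.lt_succ_of_le (Nat.pair_le_pair hx1 hx2)), Nat.unpair_pair _ _⟩,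
      ⟨hx0, hx1, hx2⟩, j, Nat.lt_succ_of_le hj, hj0, inMultiple_of_mem_smul_body hj0 hmem ?_⟩
    have hguard := h.1
    rw [length_answers] at hguard
    exact (encode_triangleQuery_le hj hx1 hx2 le_rfl le_rfl).trans_lt hguard

theorem nodup_indecomposables_boxElements (s : ℕ × List Bool) (c : FrameCode) :
    (indecomposables (boxElements s c)).Nodup := by
  refine List.Nodup.filter _ (List.Nodup.filter _ (List.Nodup.map ?_ List.nodup_range))
  exact Nat.pairEquiv.symm.injective

theorem isMinimalGeneratingSystem_of_frameVerified {n : ℕ} {c : FrameCode}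
    (h : FrameVerified (F.coordinates.length, F.answers n) c) :
    IsMinimalGeneratingSystem F.semigroup
      {g | g ∈ indecomposables (boxElements (F.coordinates.length, F.answers n) c)} := by
  have hmem := mem_boxElements_iff h
  refine isMinimalGeneratingSystem_indecomposables
    (fun x hx => ⟨((hmem x).1 hx).2, ((hmem x).1 hx).1.1⟩) (fun x hx => ?_) ?_
  · refine AddSubmonoid.closure_le.2 ?_ ((isLatticeFrame_of_frameVerified h).mem_closure hx)
    rintro y ⟨hy, h1, h2⟩
    by_cases hy0 : y = 0
    · rw [hy0]
      exact zero_mem _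
    · exact AddSubmonoid.subset_closure ((hmem y).2 ⟨⟨hy0, h1, h2⟩, hy⟩)
  · intro y hy z hz hy0 hz0 hyz
    obtain ⟨⟨_, h1, h2⟩, _⟩ := (hmem _).1 hyz
    simp only [Prod.fst_add, Prod.snd_add] at h1 h2
    exact ⟨(hmem y).2 ⟨⟨hy0, by omega, by omega⟩, hy⟩, (hmem z).2 ⟨⟨hz0, by omega, by omega⟩, hz⟩⟩

/-- The semigroup is finitely generated if and only if both extremal rays contain rational points
of the polygon. -/
theorem fg_iff {e₁ e₂ : ℝ × ℝ} (he₁ : e₁ ∈ F.points) (he₂ : e₂ ∈ F.points)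
    (H₁ : ∀ p ∈ F.points, 0 ≤ crossForm e₁ p) (H₂ : ∀ p ∈ F.points, crossForm e₂ p ≤ 0)
    (hD : 0 < crossForm e₁ e₂) :
    F.semigroup.FG ↔
      HasNonzeroRationalPoint (F.body ∩ (Submodule.span ℝ {e₁} : Submodule ℝ (ℝ × ℝ))) ∧
      HasNonzeroRationalPoint (F.body ∩ (Submodule.span ℝ {e₂} : Submodule ℝ (ℝ × ℝ))) := by
  have h₁ : e₁ ≠ 0 := by rintro rfl; simp at hD
  have h₂ : e₂ ≠ 0 := by rintro rfl; simp at hD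
  constructor
  · intro hfg
    constructor
    · obtain ⟨a, b, hab, hm, h0⟩ := exists_rational_of_fg hfg H₁ (F.mem_body_of_mem_points he₁) h₁
        (by rw [crossForm_apply]; ring)
      exact ⟨a, b, hab, hm, (mem_span_iff_crossForm h₁).2 h0⟩
    · obtain ⟨a, b, hab, hm, h0⟩ := exists_rational_of_fg (f := -crossForm e₂) hfg
        (fun p hp => neg_nonneg.2 (H₂ p hp)) (F.mem_body_of_mem_points he₂) h₂
        (by rw [LinearMap.neg_apply, crossForm_apply]; ring)
      exact ⟨a, b, hab, hm, (mem_span_iff_crossForm h₂).2 (neg_eq_zero.1 h0)⟩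
  · rintro ⟨hr₁, hr₂⟩
    obtain ⟨d, K, u, v, h⟩ := exists_isLatticeFrame H₁ H₂ he₁ he₂ hD hr₁ hr₂
    exact h.fg

end ConvexPolygon

/-! ### The main theorem -/

theorem mainTheorem1 :
    (∀ F : ConvexPolygon, ∃ τ₁ τ₂ : Submodule ℝ (ℝ × ℝ),
      τ₁ ≠ τ₂ ∧
      (∀ τ : Submodule ℝ (ℝ × ℝ),
        IsExtremalRay (rationalCone F.body) τ ↔ τ = τ₁ ∨ τ = τ₂) ∧
      (F.semigroup.FG ↔
        HasNonzeroRationalPoint (F.body ∩ τ₁) ∧ HasNonzeroRationalPoint (F.body ∩ τ₂))) ∧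
    (∃ A : RealAlgorithm (List (ℕ × ℕ)), ∀ F : ConvexPolygon, F.semigroup.FG →
      ∃ L : List (ℕ × ℕ), A.Outputs F.coordinates L ∧ L.Nodup ∧
        IsMinimalGeneratingSystem F.semigroup {g | g ∈ L}) := by
  constructor
  · intro F
    obtain ⟨e₁, he₁, e₂, he₂, H₁, H₂, hD⟩ := F.exists_extremal
    refine ⟨_, _, fun heq => ?_, ConvexPolygon.isExtremalRay_iff he₁ he₂ H₁ H₂ hD,
      ConvexPolygon.fg_iff he₁ he₂ H₁ H₂ hD⟩
    have hmem : e₂ ∈ Submodule.span ℝ {e₁} := heq ▸ Submodule.mem_span_singleton_self e₂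
    rw [ConvexPolygon.mem_span_iff_crossForm (by rintro rfl; simp at hD)] at hmem
    exact hD.ne' hmem
  -- After `n` answers the candidate tested is coded by the first component of `n.unpair`, so every
  -- candidate comes up at arbitrarily late steps.
  · have hcode : Primrec fun s : ℕ × List Bool =>
        Denumerable.ofNat FrameCode s.2.length.unpair.1 :=
      (Primrec.ofNat FrameCode).comp (Primrec.fst.comp (Primrec.unpair.comp
        (Primrec.list_length.comp Primrec.snd)))
    obtain ⟨A, hA⟩ := exists_realAlgorithm_of_primrec primrec_signQuestion
      (primrec_frameVerified Primrec.id hcode)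
      (primrec_indecomposables.comp (primrec_boxElements Primrec.id hcode))
    refine ⟨A, fun F hfg => ?_⟩
    obtain ⟨e₁, he₁, e₂, he₂, H₁, H₂, hD⟩ := F.exists_extremal
    obtain ⟨hr₁, hr₂⟩ := (ConvexPolygon.fg_iff he₁ he₂ H₁ H₂ hD).1 hfg
    obtain ⟨d, K, u, v, h⟩ := ConvexPolygon.exists_isLatticeFrame H₁ H₂ he₁ he₂ hD hr₁ hr₂
    obtain ⟨N, hN⟩ := Filter.eventually_atTop.1 h.eventually_frameVerified
    obtain ⟨n, hn, hout⟩ := hA F.coordinates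
      -- At this step the existing frame is the candidate, and the step is at least `N`, so it is
      -- verified. The algorithm may stop earlier with another frame, which is sound as well.
      ⟨Nat.pair (Encodable.encode ((d, K, u, v) : FrameCode)) N, by
        simp only [length_signAnswers, Nat.unpair_pair, Denumerable.ofNat_encode]
        exact hN _ (Nat.right_le_pair _ _)⟩
    exact ⟨_, hout, ConvexPolygon.nodup_indecomposables_boxElements _ _,
      ConvexPolygon.isMinimalGeneratingSystem_of_frameVerified hn⟩
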